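/- Logarithms are to base $2$, $\mathbb{Z}_q$ is the ring of integers modulo $q$, and for real $x$ and integer $\alpha\ge 1$ we write $\binom{x}{\alpha}=x(x-1)\cdots(x-\alpha+1)/\alpha!$. A linear code of length $m$ over $\mathbb{Z}_q$ is a $\mathbb{Z}_q$-submodule $\mathcal{C}\subseteq\mathbb{Z}_q^m$; a matrix $G\in\mathbb{Z}_q^{m\times k}$ generates $\mathcal{C}$ if $\mathcal{C}=\{Gx : x\in\mathbb{Z}_q^k\}$; the weight of a codeword is the number of its nonzero coordinates; and removing a set $S\subseteq[m]$ of coordinates (rows) replaces $\mathcal{C}$ by the code of the restrictions of its codewords to $[m]\setminus S$. **Theorem.** Let $q\ge 2$, $n\ge 1$, $d\ge 1$ be integers and let $\mathcal{C}\subseteq\mathbb{Z}_q^m$ be a linear code with at most $q^n$ distinct codewords. Then there is a set $S\subseteq[m]$ of at most $n\log(q)\cdot d$ coordinates such that, after removing $S$, for every integer $\alpha\ge 1$ the resulting code has at most $$\max\left\{1,\binom{n\log q}{\alpha}\right\}\cdot q^{\alpha+1}$$ distinct codewords of weight at most $\alpha d$. (The binomial coefficient is at least $1$ for $\alpha\le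 n\log q$, so the maximum matters only for $\alpha>n\log q$.) Further, $S$ can be covered efficiently: there is a single deterministic algorithm (a program for a random access machine with bit cost) that, given $q,n,d$ in binary and any matrix $G\in\mathbb{Z}_q^{m\times k}$ generating $\mathcal{C}$, outputs in time polynomial in $m,k,\log q,\log n,\log d$ a set $T\subseteq[m]$ with $$S\subseteq T\qquad\text{and}\qquad |T|\le n\,d\,\log(q)\,(\log n+\log q).$$ -/

import Mathlib

/-! ### Codes over `ZMod q` -/

/-- The code obtained from `C` by removing the coordinates (rows) in `S`. -/
def puncture {q m : ℕ} (C : Submodule (ZMod q) (Fin m → ZMod q)) (S : Finset (Fin m)) :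
    Submodule (ZMod q) ({i : Fin m // i ∉ S} → ZMod q) :=
  C.map (LinearMap.funLeft (ZMod q) (ZMod q) Subtype.val)

/-- The number of distinct codewords of Hamming weight at most `w`. -/
noncomputable def numLightCodewords {q : ℕ} {ι : Type} [Fintype ι]
    (C : Submodule (ZMod q) (ι → ZMod q)) (w : ℕ) : ℕ :=
  Set.ncard {c : ι → ZMod q | c ∈ C ∧ hammingNorm c ≤ w}

/-! ### A random access machine with bit cost

A program is a structured program (assignments, branching, while loops) with random access to
finitely many infinite arrays ("banks") of natural numbers. Every operation is charged according
to the bit lengths of the numbers involved; an arithmetic operation costs the product of the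
lengths of its operands, the cost of the schoolbook algorithms. -/

/-- `M b i` is the content of cell `i` of bank `b`. -/
abbrev Memory : Type := ℕ → ℕ → ℕ

/-- Store `v` in cell `i` of bank `b`. -/
def Memory.write (M : Memory) (b i v : ℕ) : Memory :=
  Function.update M b (Function.update (M b) i v)

inductive ArithOp : Type
  | add
  | sub
  | mul
  | div
  | mod

/-- Arithmetic of natural numbers: truncated subtraction, division with remainder. -/
def ArithOp.apply : ArithOp → ℕ → ℕ → ℕ
  | .add, a, b => a + b
  | .sub, a, b => a - b
  | .mul, a, b => a * b
  | .div, a, b => a / b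
  | .mod, a, b => a % b

inductive Expr : Type
  | const (c : ℕ)
  | read (b : ℕ) (i : Expr)
  | op (o : ArithOp) (e₁ e₂ : Expr)

def Expr.eval (M : Memory) : Expr → ℕ
  | .const c => c
  | .read b i => M b (i.eval M)
  | .op o e₁ e₂ => o.apply (e₁.eval M) (e₂.eval M)

/-- Bit cost of evaluating an expression; `Nat.size a` is the number of binary digits of `a`. -/
def Expr.cost (M : Memory) : Expr → ℕ
  | .const c => 1 + Nat.size c
  | .read b i => i.cost M + 1 + Nat.size (i.eval M) + Nat.size (M b (i.eval M))
  | .op _ e₁ e₂ =>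
      e₁.cost M + e₂.cost M + (1 + Nat.size (e₁.eval M)) * (1 + Nat.size (e₂.eval M))

inductive Program : Type
  | skip
  | assign (b : ℕ) (i e : Expr)
  | seq (c₁ c₂ : Program)
  | cond (e : Expr) (c₁ c₂ : Program)
  | loop (e : Expr) (c : Program)

/-- `c.Run M M' t`: started in memory `M`, the program `c` halts in memory `M'` at total cost `t`.
The condition of `cond` and of the while loop `loop` counts as true if it is nonzero. -/
inductive Program.Run : Program → Memory → Memory → ℕ → Prop
  | skip (M : Memory) : Run .skip M M 1
  | assign (M : Memory) (b : ℕ) (i e : Expr) :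
      Run (.assign b i e) M (M.write b (i.eval M) (e.eval M))
        (i.cost M + e.cost M + 1 + Nat.size (i.eval M) + Nat.size (e.eval M))
  | seq {c₁ c₂ : Program} {M M' M'' : Memory} {t₁ t₂ : ℕ} :
      Run c₁ M M' t₁ → Run c₂ M' M'' t₂ → Run (.seq c₁ c₂) M M'' (t₁ + t₂)
  | cond_true {e : Expr} {c₁ c₂ : Program} {M M' : Memory} {t : ℕ} :
      e.eval M ≠ 0 → Run c₁ M M' t → Run (.cond e c₁ c₂) M M' (e.cost M + 1 + t)
  | cond_false {e : Expr} {c₁ c₂ : Program} {M M' : Memory} {t : ℕ} :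
      e.eval M = 0 → Run c₂ M M' t → Run (.cond e c₁ c₂) M M' (e.cost M + 1 + t)
  | loop_true {e : Expr} {c : Program} {M M' M'' : Memory} {t₁ t₂ : ℕ} :
      e.eval M ≠ 0 → Run c M M' t₁ → Run (.loop e c) M' M'' t₂ →
        Run (.loop e c) M M'' (e.cost M + 1 + t₁ + t₂)
  | loop_false {e : Expr} {c : Program} {M : Memory} :
      e.eval M = 0 → Run (.loop e c) M M (e.cost M + 1)

/-- The initial memory on input `(G, n, d)`: bank `0` holds `m, k, q, n, d`, bank `1` holds the
entries of `G`, as integers in `[0, q)`, row by row; all other cells are `0`. -/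
def inputMemory {q m k : ℕ} (G : Matrix (Fin m) (Fin k) (ZMod q)) (n d : ℕ) : Memory
  | 0, 0 => m
  | 0, 1 => k
  | 0, 2 => q
  | 0, 3 => n
  | 0, 4 => d
  | 1, i => if h : i < m * k then
      (G (Fin.divNat ⟨i, h⟩) (Fin.modNat ⟨i, h⟩)).val else 0
  | _, _ => 0

/-- The output: the subset of `[m]` whose indicator vector is left in bank `2`. -/
def outputSet (m : ℕ) (M : Memory) : Finset (Fin m) :=
  Finset.univ.filter fun i => M 2 i ≠ 0

/-! Let N(S) be the number of codewords supported in S, and let S maximise d log N(S) - |S|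
(`IsExtremal`). Every property of S comes from comparing it with another set. Comparison with ∅
gives |S| ≤ d log N(S) ≤ d n log q. Comparison with supersets shows that in the punctured code the
codewords vanishing on U number at most 2^(r/d), where r counts the coordinates outside U
(`puncture_sparse`). Comparison with S \ A shows that fixing zeros on A ⊆ S costs at least |A|/d
bits of N(S) (`card_le_of_subset`).

Light codewords: a subcode of the punctured code with 2^L words has support V of size at least dL. A
word of weight at most αd vanishes at |V| - αd or more points of V, and imposing a zero at a point
of V at least halves the subcode. Double counting bounds the count at L by L/(L - α) times the bound
at L - 1, which is the recursion of the binomial coefficient; the start L ≤ α + 1 is the trivial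
bound 2^(α+1) (`numLightCodewords_vanishingOn_le`).

Covering: the algorithm never computes S. Each coordinate carries an accumulator, initially 1, and
is active while this is below q^64. In a round the active coordinates are visited in decreasing
order, and the accumulator of e is multiplied by its jump, the number of values at e of codewords
vanishing on the later active coordinates. The jumps of a round multiply to at most |C|, so R rounds
deactivate at most nR/64 coordinates (`card_removed_mul_le`). On the other hand, extremality forces
the active part B of S to gain at least max(1, |B|/d) bits per round, so the total deficit of B
decays geometrically, and R ≈ 64 d log q (log n + log q) rounds deactivate all of S
(`IsExtremal.subset_removed`). The constant 64 makes the losses from overshoot and rounding small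
enough for the stated bound.

Jumps are computable because Euclidean column operations keep k + 1 generators of the current
subcode (`contractRow_spec`). If m ≤ d, all of [m] is an admissible answer; otherwise d < m, so R is
polynomial in the input size although d is given in binary. -/

/-! ### Generalised binomial coefficients -/

theorem Real.choose_eq_prod_div (x : ℝ) (α : ℕ) :
    Ring.choose x α = (∏ i ∈ Finset.range α, (x - i)) / (α.factorial : ℝ) := by
  rw [Ring.choose_eq_smul, ← descPochhammer_eval_eq_prod_range, smul_eq_mul, div_eq_inv_mul,
    ← descPochhammer_map (algebraMap ℤ ℝ), Polynomial.eval_map_algebraMap, Polynomial.aeval_eq_smeval]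

/-- All factors x - i are nonnegative once α ≤ x. Below that the product may change sign, which is
why the counting bound uses the maximum of L and α as its upper argument. -/
theorem Real.choose_le_choose_left {x y : ℝ} {α : ℕ} (hx : (α : ℝ) ≤ x) (hxy : x ≤ y) :
    Ring.choose x α ≤ Ring.choose y α := by
  rw [Real.choose_eq_prod_div, Real.choose_eq_prod_div]
  refine div_le_div_of_nonneg_right (Finset.prod_le_prod ?_ ?_) (by positivity)
  · intro i hi
    have : (i : ℝ) ≤ α := by exact_mod_cast (Finset.mem_range.1 hi).le
    linarith
  · intro i _
    linarith

theorem Real.one_le_choose {x : ℝ} {α : ℕ} (hx : (α : ℝ) ≤ x) : 1 ≤ Ring.choose x α := by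
  have h := Real.choose_le_choose_left le_rfl hx
  rwa [Ring.choose_natCast, Nat.choose_self, Nat.cast_one] at h

/-- Both sides are x(x - 1)⋯(x - α)/α!. This is the recursion that closes the induction for light
codewords. -/
theorem Real.sub_mul_choose (x : ℝ) (α : ℕ) :
    (x - α) * Ring.choose x α = x * Ring.choose (x - 1) α := by
  rw [Real.choose_eq_prod_div, Real.choose_eq_prod_div, ← mul_div_assoc, ← mul_div_assoc, mul_comm,
    ← Finset.prod_range_succ (fun i : ℕ => x - (i : ℝ)), Finset.prod_range_succ']
  simp only [Nat.cast_add, Nat.cast_one, Nat.cast_zero, sub_zero]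
  rw [mul_comm]
  congr 2
  exact Finset.prod_congr rfl fun i _ => by ring

/-! ### Subcodes vanishing on a set of coordinates -/

section Vanishing

variable {q : ℕ} {ι : Type} (C : Submodule (ZMod q) (ι → ZMod q))

/-- The codewords of `C` that vanish on `A`. -/
def vanishingOn (A : Finset ι) : Submodule (ZMod q) (ι → ZMod q) where
  carrier := {c | c ∈ C ∧ ∀ i ∈ A, c i = 0}
  add_mem' ha hb := ⟨C.add_mem ha.1 hb.1, fun i hi => by simp [ha.2 i hi, hb.2 i hi]⟩
  zero_mem' := ⟨C.zero_mem, fun _ _ => rfl⟩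
  smul_mem' r c hc := ⟨C.smul_mem r hc.1, fun i hi => by simp [hc.2 i hi]⟩

/-- The number of values that the codewords vanishing on `A` take at `e`. -/
noncomputable def jump (A : Finset ι) (e : ι) : ℕ :=
  Nat.card ((vanishingOn C A).map (LinearMap.proj e))

variable {C}

theorem mem_vanishingOn {A : Finset ι} {c : ι → ZMod q} :
    c ∈ vanishingOn C A ↔ c ∈ C ∧ ∀ i ∈ A, c i = 0 := Iff.rfl

theorem vanishingOn_anti {A B : Finset ι} (h : A ⊆ B) : vanishingOn C B ≤ vanishingOn C A :=
  fun _ hc => ⟨hc.1, fun i hi => hc.2 i (h hi)⟩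

theorem jump_anti [NeZero q] {A B : Finset ι} (h : A ⊆ B) (e : ι) : jump C B e ≤ jump C A e :=
  Nat.card_mono (Set.toFinite _) (Submodule.map_mono (vanishingOn_anti h))

theorem jump_dvd (A : Finset ι) (e : ι) : jump C A e ∣ q := by
  have := AddSubgroup.card_addSubgroup_dvd_card
    ((vanishingOn C A).map (LinearMap.proj e : (ι → ZMod q) →ₗ[ZMod q] ZMod q)).toAddSubgroup
  rwa [Nat.card_zmod] at this

theorem jump_pos [NeZero q] (A : Finset ι) (e : ι) : 0 < jump C A e :=
  Nat.pos_of_dvd_of_pos (jump_dvd A e) (NeZero.pos q)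

theorem two_le_jump [NeZero q] {A : Finset ι} {e : ι} {c : ι → ZMod q} (hc : c ∈ vanishingOn C A)
    (he : c e ≠ 0) : 2 ≤ jump C A e := by
  have : Nontrivial ((vanishingOn C A).map (LinearMap.proj e : (ι → ZMod q) →ₗ[ZMod q] ZMod q)) :=
    ⟨⟨⟨c e, c, hc, rfl⟩, 0, fun h => he (congrArg Subtype.val h)⟩⟩
  exact Finite.one_lt_card

theorem card_vanishingOn_pos [NeZero q] [Finite ι] (A : Finset ι) : 0 < Nat.card (vanishingOn C A) :=
  Nat.card_pos

/-- Evaluation at e on the subcode vanishing on A has the values counted by `jump` as its range and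
the codewords that also vanish at e as its kernel. -/
theorem jump_mul_card [DecidableEq ι] (A : Finset ι) (e : ι) :
    jump C A e * Nat.card (vanishingOn C (insert e A)) = Nat.card (vanishingOn C A) := by
  let f : vanishingOn C A →ₗ[ZMod q] ZMod q :=
    (LinearMap.proj e : (ι → ZMod q) →ₗ[ZMod q] ZMod q).comp (vanishingOn C A).subtype
  have h1 : Nat.card f.range = jump C A e := by
    simp only [f, jump]
    rw [LinearMap.range_comp, Submodule.range_subtype]
  have h2 : Nat.card f.ker = Nat.card (vanishingOn C (insert e A)) := by
    refine Nat.card_congr ⟨fun x => ⟨x.1.1, x.1.2.1, ?_⟩,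
      fun x => ⟨⟨x.1, x.2.1, fun i hi => x.2.2 i (Finset.mem_insert_of_mem hi)⟩, ?_⟩,
      fun x => rfl, fun x => rfl⟩
    · intro i hi
      rcases Finset.mem_insert.1 hi with rfl | hi
      · exact x.2
      · exact x.1.2.2 i hi
    · exact x.2.2 e (Finset.mem_insert_self _ _)
  rw [← h1, ← h2, Submodule.card_eq_card_quotient_mul_card f.ker,
    Nat.card_congr f.quotKerEquivRange.toEquiv, mul_comm]

/-- Telescoping of `jump_mul_card` while B is added to F in decreasing order. The induction inserts
a new minimum, which leaves the sets of later elements of the others unchanged. -/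
theorem prod_jump_mul_card [LinearOrder ι] (F B : Finset ι) :
    (∏ e ∈ B, jump C (F ∪ B.filter (e < ·)) e) * Nat.card (vanishingOn C (F ∪ B)) =
      Nat.card (vanishingOn C F) := by
  induction B using Finset.induction_on_min with
  | empty => simp
  | insert a B ha ih =>
    have haB : a ∉ B := fun h => lt_irrefl _ (ha a h)
    rw [Finset.prod_insert haB]
    have h1 : (insert a B).filter (a < ·) = B := by
      rw [Finset.filter_insert, if_neg (lt_irrefl a), Finset.filter_true_of_mem ha]
    have h2 : ∀ e ∈ B, (insert a B).filter (e < ·) = B.filter (e < ·) := fun e he => by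
      rw [Finset.filter_insert, if_neg (ha e he).le.not_gt]
    rw [h1, Finset.prod_congr rfl fun e he => by rw [h2 e he], mul_right_comm,
      Finset.union_insert, jump_mul_card, mul_comm, ih]

end Vanishing

/-! ### Counting light codewords -/

section Counting

variable {q : ℕ} [NeZero q] {ι : Type} [Fintype ι] {C : Submodule (ZMod q) (ι → ZMod q)}

theorem numLightCodewords_le_card (w : ℕ) : numLightCodewords C w ≤ Nat.card C :=
  Set.ncard_le_ncard (fun _ hc => hc.1) (Set.toFinite _)

/-- Double counting of pairs (c, j) with c light, j in V and c j = 0: every light c occurs in at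
least |V| - w pairs. -/
theorem numLightCodewords_mul_le [DecidableEq ι] (A V : Finset ι) (w : ℕ) :
    (numLightCodewords (vanishingOn C A) w : ℝ) * ((V.card : ℝ) - w) ≤
      ∑ j ∈ V, (numLightCodewords (vanishingOn C (insert j A)) w : ℝ) := by
  classical
  have key : ∀ B : Finset ι, numLightCodewords (vanishingOn C B) w =
      (Finset.univ.filter fun c => c ∈ vanishingOn C B ∧ hammingNorm c ≤ w).card := fun B => by
    rw [numLightCodewords, ← Set.ncard_coe_finset]
    congr 1
    ext c
    simp
  simp only [key]
  have h1 : ∀ j ∈ V, (Finset.univ.filter fun c =>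
      c ∈ vanishingOn C (insert j A) ∧ hammingNorm c ≤ w) =
      (Finset.univ.filter fun c => c ∈ vanishingOn C A ∧ hammingNorm c ≤ w).filter
        fun c => c j = 0 := fun j _ => by
    ext c
    simp only [Finset.mem_filter, Finset.mem_univ, true_and, mem_vanishingOn,
      Finset.forall_mem_insert]
    tauto
  rw [Finset.sum_congr rfl fun j hj => by rw [h1 j hj]]
  simp only [Finset.card_filter _ (Finset.filter _ _), Nat.cast_sum]
  rw [Finset.sum_comm, ← nsmul_eq_mul]
  refine Finset.card_nsmul_le_sum _ _ _ fun c hc => ?_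
  have hw : hammingNorm c ≤ w := (Finset.mem_filter.1 hc).2.2
  have h2 : V.card ≤ (V.filter fun j => c j = 0).card + w := by
    rw [← Finset.card_filter_add_card_filter_not (s := V) (fun j => c j = 0)]
    refine Nat.add_le_add_left (le_trans (Finset.card_le_card ?_) hw) _
    exact Finset.filter_subset_filter _ (Finset.subset_univ _)
  rw [Finset.card_filter] at h2
  have h3 : (V.card : ℝ) ≤ ((∑ j ∈ V, if c j = 0 then 1 else 0 : ℕ) : ℝ) + w := by
    exact_mod_cast h2
  push_cast at h3 ⊢
  linarith

/-- Strong induction on the size of the subcode. The hypothesis is required for all U because the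
induction passes to subcodes with more forced zeros. -/
theorem numLightCodewords_vanishingOn_le {d α : ℕ} (hd : 1 ≤ d) (hα : 1 ≤ α)
    (h : ∀ U : Finset ι, (d : ℝ) * Real.logb 2 (Nat.card (vanishingOn C U)) ≤ (Fintype.card ι - U.card : ℝ))
    (U : Finset ι) :
    (numLightCodewords (vanishingOn C U) (α * d) : ℝ) ≤
      Ring.choose (max (Real.logb 2 (Nat.card (vanishingOn C U))) (α : ℝ)) α * 2 ^ (α + 1) := by
  classical
  generalize hN : Nat.card (vanishingOn C U) = N
  induction N using Nat.strong_induction_on generalizing U with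
  | _ N ih =>
  have hNpos : 0 < N := hN ▸ card_vanishingOn_pos U
  set L := Real.logb 2 N with hL
  have hNL : (N : ℝ) = 2 ^ L := (Real.rpow_logb two_pos (by norm_num) (by exact_mod_cast hNpos)).symm
  have hle : (numLightCodewords (vanishingOn C U) (α * d) : ℝ) ≤ N := by
    rw [← hN]; exact_mod_cast numLightCodewords_le_card _
  rcases le_or_gt L (α + 1) with hsmall | hbig
  · calc (numLightCodewords (vanishingOn C U) (α * d) : ℝ) ≤ 2 ^ L := hNL ▸ hle
      _ ≤ (2 : ℝ) ^ ((α + 1 : ℕ) : ℝ) :=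
        Real.rpow_le_rpow_of_exponent_le one_le_two (by push_cast; exact hsmall)
      _ = 1 * 2 ^ (α + 1) := by rw [Real.rpow_natCast, one_mul]
      _ ≤ _ := mul_le_mul_of_nonneg_right (Real.one_le_choose (le_max_right _ _)) (by positivity)
  -- V is the support of the subcode. Vanishing on its complement is no further restriction, so the
  -- hypothesis at Vᶜ yields dL ≤ |V|.
  · set V : Finset ι := Finset.univ.filter fun j => ∃ c ∈ vanishingOn C U, c j ≠ 0 with hV
    have hVc : vanishingOn C Vᶜ = vanishingOn C U := by
      ext c
      refine ⟨fun hc => ⟨hc.1, fun i hi => hc.2 i ?_⟩, fun hc => ⟨hc.1, fun i hi => ?_⟩⟩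
      · simp only [hV, Finset.mem_compl, Finset.mem_filter, Finset.mem_univ, true_and, not_exists,
          not_and, not_not]
        exact fun c hc => hc.2 i hi
      · simp only [hV, Finset.mem_compl, Finset.mem_filter, Finset.mem_univ, true_and, not_exists,
          not_and, not_not] at hi
        exact hi c hc
    have hVL : (d : ℝ) * L ≤ V.card := by
      have := h Vᶜ
      rw [hVc, hN, Finset.card_compl, Nat.cast_sub (Finset.card_le_univ _), sub_sub_cancel] at this
      exact this
    have hd' : (1 : ℝ) ≤ d := by exact_mod_cast hd
    have hα' : (1 : ℝ) ≤ α := by exact_mod_cast hα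
    have hstep : ∀ j ∈ V, (numLightCodewords (vanishingOn C (insert j U)) (α * d) : ℝ) ≤
        Ring.choose (L - 1) α * 2 ^ (α + 1) := by
      intro j hj
      obtain ⟨c, hc, hcj⟩ := (Finset.mem_filter.1 hj).2
      have h2 := two_le_jump hc hcj
      have h3 := jump_mul_card (C := C) U j
      have hpos := card_vanishingOn_pos (C := C) (insert j U)
      have h4 : 2 * Nat.card (vanishingOn C (insert j U)) ≤ N := by
        rw [← hN, ← h3]; exact Nat.mul_le_mul_right _ h2
      refine (ih _ (by omega) _ rfl).trans
        (mul_le_mul_of_nonneg_right (Real.choose_le_choose_left (le_max_right _ _) ?_) (by positivity))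
      -- A zero at j ∈ V at least halves the subcode, so its logarithm drops by 1; and α ≤ L - 1
      -- since L > α + 1.
      refine max_le ?_ (by linarith)
      have h5 : Real.logb 2 (2 * (Nat.card (vanishingOn C (insert j U)) : ℝ)) ≤ L :=
        Real.logb_le_logb_of_le one_lt_two (by positivity) (by exact_mod_cast h4)
      rw [Real.logb_mul two_ne_zero (by positivity), Real.logb_self_eq_one one_lt_two] at h5
      linarith
    have hsum := (numLightCodewords_mul_le U V (α * d)).trans (Finset.sum_le_card_nsmul _ _ _ hstep)
    rw [nsmul_eq_mul, Nat.cast_mul] at hsum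
    set X : ℝ := (numLightCodewords (vanishingOn C U) (α * d) : ℝ)
    have hX : 0 ≤ X := Nat.cast_nonneg _
    have hrec := Real.sub_mul_choose L α
    rw [max_eq_left (by linarith)]
    have hVpos : 0 < (V.card : ℝ) := by nlinarith
    have h6 : (V.card : ℝ) * (X * (L - α)) ≤
        V.card * (L * (Ring.choose (L - 1) α * 2 ^ (α + 1))) := by
      -- After cancelling |V|L this is α times the inequality dL ≤ |V|.
      have : (V.card : ℝ) * (L - α) ≤ L * (V.card - α * d) := by nlinarith
      calc (V.card : ℝ) * (X * (L - α)) = X * (V.card * (L - α)) := by ring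
        _ ≤ X * (L * (V.card - α * d)) := mul_le_mul_of_nonneg_left this hX
        _ = L * (X * (V.card - α * d)) := by ring
        _ ≤ L * (V.card * (Ring.choose (L - 1) α * 2 ^ (α + 1))) :=
          mul_le_mul_of_nonneg_left hsum (by linarith)
        _ = _ := by ring
    have h7 := le_of_mul_le_mul_left h6 hVpos
    have h8 : (L - α) * X ≤ (L - α) * (Ring.choose L α * 2 ^ (α + 1)) := by
      calc (L - α) * X = X * (L - α) := mul_comm _ _
        _ ≤ _ := h7
        _ = (L * Ring.choose (L - 1) α) * 2 ^ (α + 1) := by ring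
        _ = _ := by rw [← hrec]; ring
    exact le_of_mul_le_mul_left h8 (by linarith)

end Counting

/-! ### An extremal set of coordinates -/

section Extremal

variable {q m : ℕ} (C : Submodule (ZMod q) (Fin m → ZMod q))

/-- `S` maximises `d * log N - |S|`, where `N` is the number of codewords supported in `S`. -/
def IsExtremal (d : ℕ) (S : Finset (Fin m)) : Prop :=
  ∀ S' : Finset (Fin m),
    d * Real.logb 2 (Nat.card (vanishingOn C S'ᶜ)) - S'.card ≤
      d * Real.logb 2 (Nat.card (vanishingOn C Sᶜ)) - S.card

theorem exists_isExtremal (d : ℕ) : ∃ S : Finset (Fin m), IsExtremal C d S := by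
  obtain ⟨S, -, hS⟩ := Finset.exists_max_image (Finset.univ : Finset (Finset (Fin m)))
    (fun S => d * Real.logb 2 (Nat.card (vanishingOn C Sᶜ)) - (S.card : ℝ)) ⟨∅, Finset.mem_univ _⟩
  exact ⟨S, fun S' => hS S' (Finset.mem_univ _)⟩

variable {C}

theorem logb_card_vanishingOn_nonneg [NeZero q] (A : Finset (Fin m)) :
    0 ≤ Real.logb 2 (Nat.card (vanishingOn C A)) :=
  Real.logb_nonneg one_lt_two (by exact_mod_cast card_vanishingOn_pos A)

theorem logb_card_vanishingOn_le [NeZero q] {n : ℕ} (hC : Nat.card C ≤ q ^ n) (A : Finset (Fin m)) :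
    Real.logb 2 (Nat.card (vanishingOn C A)) ≤ n * Real.logb 2 q := by
  have h1 : Nat.card (vanishingOn C A) ≤ Nat.card C :=
    Nat.card_mono (Set.toFinite (C : Set (Fin m → ZMod q))) fun _ hc => hc.1
  rw [← Real.logb_pow]
  exact Real.logb_le_logb_of_le one_lt_two (by exact_mod_cast card_vanishingOn_pos A)
    (by exact_mod_cast h1.trans hC)

/-- Restriction to the complement of S, applied to the codewords vanishing on U, has the codewords
supported in S as its kernel. -/
theorem card_puncture_vanishingOn (S : Finset (Fin m)) (U : Finset {i : Fin m // i ∉ S}) :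
    Nat.card (vanishingOn (puncture C S) U) * Nat.card (vanishingOn C Sᶜ) =
      Nat.card (vanishingOn C (U.map (Function.Embedding.subtype _))) := by
  let f : vanishingOn C (U.map (Function.Embedding.subtype _)) →ₗ[ZMod q]
      ({i : Fin m // i ∉ S} → ZMod q) :=
    (LinearMap.funLeft (ZMod q) (ZMod q) Subtype.val).comp (Submodule.subtype _)
  have h1 : Nat.card f.range = Nat.card (vanishingOn (puncture C S) U) := by
    congr 2
    ext c
    constructor
    · rintro ⟨x, rfl⟩
      refine ⟨⟨x.1, x.2.1, rfl⟩, fun i hi => x.2.2 i.1 (Finset.mem_map_of_mem _ hi)⟩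
    · rintro ⟨⟨x, hx, rfl⟩, h0⟩
      refine ⟨⟨x, hx, fun i hi => ?_⟩, rfl⟩
      obtain ⟨j, hj, rfl⟩ := Finset.mem_map.1 hi
      exact h0 j hj
  have h2 : Nat.card f.ker = Nat.card (vanishingOn C Sᶜ) := by
    refine Nat.card_congr ⟨fun x => ⟨x.1.1, x.1.2.1, ?_⟩, fun x => ⟨⟨x.1, x.2.1, ?_⟩, ?_⟩,
      fun x => rfl, fun x => rfl⟩
    · intro i hi
      exact congrFun x.2 ⟨i, Finset.mem_compl.1 hi⟩
    · intro i hi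
      obtain ⟨j, hj, rfl⟩ := Finset.mem_map.1 hi
      exact x.2.2 j.1 (Finset.mem_compl.2 j.2)
    · ext i
      exact x.2.2 i.1 (Finset.mem_compl.2 i.2)
  rw [← h1, ← h2, Submodule.card_eq_card_quotient_mul_card f.ker,
    Nat.card_congr f.quotKerEquivRange.toEquiv, mul_comm]

namespace IsExtremal

variable {S : Finset (Fin m)} {d : ℕ}

theorem card_le [NeZero q] (hS : IsExtremal C d S) :
    (S.card : ℝ) ≤ d * Real.logb 2 (Nat.card (vanishingOn C Sᶜ)) := by
  have h := hS ∅
  have := mul_nonneg (Nat.cast_nonneg (α := ℝ) d) (logb_card_vanishingOn_nonneg (C := C) ∅ᶜ)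
  simp only [Finset.card_empty, Nat.cast_zero] at h
  linarith

/-- Comparison of S with S \ A. -/
theorem card_le_of_subset (hS : IsExtremal C d S) {A : Finset (Fin m)} (hA : A ⊆ S) :
    (A.card : ℝ) ≤ d * (Real.logb 2 (Nat.card (vanishingOn C Sᶜ)) -
      Real.logb 2 (Nat.card (vanishingOn C (Sᶜ ∪ A)))) := by
  have h := hS (S \ A)
  have h1 : (S \ A)ᶜ = Sᶜ ∪ A := by
    ext i; simp only [Finset.mem_compl, Finset.mem_sdiff, Finset.mem_union]; tauto
  rw [h1, Finset.card_sdiff_of_subset hA, Nat.cast_sub (Finset.card_le_card hA)] at h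
  linarith

/-- Comparison of S with the complement of U, a superset of S. The factor N(S) from
`card_puncture_vanishingOn` cancels. -/
theorem puncture_sparse [NeZero q] (hS : IsExtremal C d S) (U : Finset {i : Fin m // i ∉ S}) :
    (d : ℝ) * Real.logb 2 (Nat.card (vanishingOn (puncture C S) U)) ≤
      (Fintype.card {i : Fin m // i ∉ S} - U.card : ℝ) := by
  have h := hS (U.map (Function.Embedding.subtype _))ᶜ
  have hp : ∀ A, (Nat.card (vanishingOn C A) : ℝ) ≠ 0 := fun A => by
    exact_mod_cast (card_vanishingOn_pos A).ne'
  have hp' : (Nat.card (vanishingOn (puncture C S) U) : ℝ) ≠ 0 := by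
    exact_mod_cast (card_vanishingOn_pos U).ne'
  have hF : Fintype.card {i : Fin m // i ∉ S} + S.card = m := by
    rw [Fintype.card_subtype_compl, Fintype.card_coe, Fintype.card_fin]
    exact Nat.sub_add_cancel (by simpa using S.card_le_univ)
  have hU : U.card ≤ m := (U.card_le_univ).trans (by omega)
  rw [compl_compl, ← card_puncture_vanishingOn, Nat.cast_mul, Real.logb_mul hp' (hp _),
    Finset.card_compl, Finset.card_map, Fintype.card_fin, Nat.cast_sub hU] at h
  have : (Fintype.card {i : Fin m // i ∉ S} : ℝ) + S.card = m := by exact_mod_cast hF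
  linarith

theorem numLightCodewords_le [NeZero q] (hS : IsExtremal C d S) {n α : ℕ} (hq : 2 ≤ q) (hd : 1 ≤ d) (hα : 1 ≤ α)
    (hC : Nat.card C ≤ q ^ n) :
    (numLightCodewords (puncture C S) (α * d) : ℝ) ≤
      max 1 (Ring.choose ((n : ℝ) * Real.logb 2 q) α) * (q : ℝ) ^ (α + 1) := by
  have h := numLightCodewords_vanishingOn_le hd hα hS.puncture_sparse ∅
  have h0 : vanishingOn (puncture C S) ∅ = puncture C S := by
    ext c; simp [mem_vanishingOn]
  have h1 := card_puncture_vanishingOn (C := C) S ∅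
  have h2 : vanishingOn C (∅ : Finset (Fin m)) = C := by
    ext c; simp [mem_vanishingOn]
  have h3 : Real.logb 2 (Nat.card (puncture C S)) ≤ n * Real.logb 2 q := by
    refine le_trans ?_ (logb_card_vanishingOn_le (C := C) hC ∅)
    rw [Finset.map_empty, h0] at h1
    rw [← h1]
    refine Real.logb_le_logb_of_le one_lt_two (by exact_mod_cast Nat.card_pos) ?_
    exact_mod_cast Nat.le_mul_of_pos_right _ (card_vanishingOn_pos _)
  rw [h0] at h
  refine h.trans (mul_le_mul ?_ ?_ (by positivity) (le_max_of_le_left zero_le_one))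
  -- For α ≤ n log q the binomial coefficient is monotone up to n log q; otherwise the upper
  -- argument is α itself and the coefficient is 1.
  · rcases le_total (α : ℝ) (n * Real.logb 2 q) with hle | hle
    · exact (Real.choose_le_choose_left (le_max_right _ _) (max_le h3 hle)).trans (le_max_right _ _)
    · rw [max_eq_right (h3.trans hle), Ring.choose_natCast, Nat.choose_self, Nat.cast_one]
      exact le_max_left _ _
  · exact pow_le_pow_left₀ two_pos.le (by exact_mod_cast hq) _

end IsExtremal

end Extremal

/-! ### Peeling off spanning sets of coordinates -/

section Peeling

variable {q m : ℕ} (C : Submodule (ZMod q) (Fin m → ZMod q)) (Q : ℕ)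

/-- The coordinates whose accumulated jump is still below `Q`. -/
def activeSet (Q : ℕ) (acc : Fin m → ℕ) : Finset (Fin m) :=
  Finset.univ.filter fun e => acc e < Q

/-- One pass over the coordinates in decreasing order, multiplying each accumulator below `Q`
by the jump of its coordinate. -/
noncomputable def peelRound (acc : Fin m → ℕ) (e : Fin m) : ℕ :=
  if acc e < Q then acc e * jump C ((activeSet Q acc).filter (e < ·)) e else acc e

variable {C} {Q} [NeZero q]

theorem mem_activeSet {acc : Fin m → ℕ} {e : Fin m} : e ∈ activeSet Q acc ↔ acc e < Q := by
  simp [activeSet]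

theorem le_peelRound (acc : Fin m → ℕ) (e : Fin m) : acc e ≤ peelRound C Q acc e := by
  unfold peelRound
  split_ifs
  · exact Nat.le_mul_of_pos_right _ (jump_pos _ _)
  · exact le_rfl

theorem activeSet_peelRound_subset (acc : Fin m → ℕ) :
    activeSet Q (peelRound C Q acc) ⊆ activeSet Q acc := fun e he =>
  mem_activeSet.2 ((le_peelRound acc e).trans_lt (mem_activeSet.1 he))

/-- By telescoping with F = ∅, the jumps of one round multiply to |C| divided by the number of
codewords vanishing on the active set. -/
theorem prod_peelRound_le (acc : Fin m → ℕ) :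
    ∏ e, peelRound C Q acc e ≤ (∏ e, acc e) * Nat.card C := by
  have h : ∀ e, peelRound C Q acc e = acc e *
      if e ∈ activeSet Q acc then jump C ((activeSet Q acc).filter (e < ·)) e else 1 := fun e => by
    simp only [peelRound, mem_activeSet]
    split_ifs <;> simp
  simp only [h]
  rw [Finset.prod_mul_distrib, Finset.prod_ite_mem, Finset.univ_inter]
  refine Nat.mul_le_mul_left _ ?_
  have h1 := prod_jump_mul_card (C := C) ∅ (activeSet Q acc)
  have h2 : vanishingOn C (∅ : Finset (Fin m)) = C := by
    ext c; simp [mem_vanishingOn]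
  rw [h2] at h1
  simp only [Finset.empty_union] at h1
  rw [← h1]
  exact Nat.le_mul_of_pos_right _ (card_vanishingOn_pos _)

theorem prod_peelRound_iterate_le (R : ℕ) :
    ∏ e, (peelRound C Q)^[R] (fun _ => 1) e ≤ Nat.card C ^ R := by
  induction R with
  | zero => simp
  | succ R ih =>
    rw [Function.iterate_succ_apply', pow_succ]
    exact (prod_peelRound_le _).trans (Nat.mul_le_mul_right _ ih)

theorem one_le_peelRound_iterate (R : ℕ) (e : Fin m) :
    1 ≤ (peelRound C Q)^[R] (fun _ => 1) e := by
  induction R with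
  | zero => simp
  | succ R ih =>
    rw [Function.iterate_succ_apply']
    exact ih.trans (le_peelRound _ _)

theorem card_removed_mul_le {n a R : ℕ} (hq : 2 ≤ q) (hC : Nat.card C ≤ q ^ n) :
    a * ((activeSet (q ^ a) ((peelRound C (q ^ a))^[R] fun _ => 1))ᶜ).card ≤ n * R := by
  set acc := (peelRound C (q ^ a))^[R] fun _ => 1 with hacc
  have h1 : (q ^ a) ^ ((activeSet (q ^ a) acc)ᶜ).card ≤ q ^ (n * R) := by
    calc (q ^ a) ^ ((activeSet (q ^ a) acc)ᶜ).card
        ≤ ∏ e ∈ (activeSet (q ^ a) acc)ᶜ, acc e := by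
          refine Finset.pow_card_le_prod _ _ _ fun e he => ?_
          simpa [mem_activeSet] using he
      _ ≤ ∏ e, acc e := by
          refine Finset.prod_le_prod_of_subset_of_one_le' (Finset.subset_univ _) fun e _ _ => ?_
          exact one_le_peelRound_iterate R e
      _ ≤ Nat.card C ^ R := prod_peelRound_iterate_le R
      _ ≤ (q ^ n) ^ R := Nat.pow_le_pow_left hC R
      _ = q ^ (n * R) := (pow_mul _ _ _).symm
  rw [← pow_mul] at h1
  exact (Nat.pow_le_pow_iff_right (by omega)).1 h1

end Peeling

/-! ### Number of rounds after which an extremal set is removed -/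

/-- A bound for the number of steps in which a quantity `x` becomes nonpositive, if every step
decreases it by `1` and by the factor `1 - 1 / D`. -/
noncomputable def decayTime (D x : ℝ) : ℝ :=
  if x ≤ D then x else D * (1 + Real.log (x / D))

/-- `decayTime D` is concave with derivative min(1, D/x) for x > 0, and x decreases by at least the
reciprocal max(1, x/D), so the tangent at x gives a decrease of at least 1. The cases below verify
this through elementary bounds for the logarithm. -/
theorem decayTime_step {D x y : ℝ} (hD : 1 ≤ D) (h1 : y ≤ x - 1) (h2 : y ≤ x - x / D) :
    decayTime D y ≤ decayTime D x - 1 := by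
  have hD0 : 0 < D := by linarith
  unfold decayTime
  rcases le_or_gt x D with hx | hx
  · rw [if_pos hx, if_pos (by linarith)]
    exact h1
  · have hx0 : 0 < x := hD0.trans hx
    rw [if_neg hx.not_ge]
    rcases le_or_gt y D with hy | hy
    · rw [if_pos hy]
      have hl := Real.one_sub_inv_le_log_of_pos (div_pos hx0 hD0)
      rw [inv_div] at hl
      -- The step crosses D. The stronger of the two bounds y ≤ x - x/D and y ≤ D is used.
      rcases le_or_gt (x - x / D) D with hxD | hxD
      · have h3 : (x - D) * (1 - 1 / D) ≤ D * (1 - D / x) := by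
          have e1 : D * (1 - D / x) = (x - D) * (D / x) := by field_simp
          rw [e1]
          refine mul_le_mul_of_nonneg_left ?_ (by linarith)
          rw [le_div_iff₀ hx0]
          have : (1 - 1 / D) * x = x - x / D := by ring
          linarith
        have h4 := mul_le_mul_of_nonneg_left hl hD0.le
        have h5 : (x - D) * (1 - 1 / D) = x - x / D - D + 1 := by field_simp; ring
        linarith
      · have h3 : D * (D / x) ≤ D - 1 := by
          rw [mul_div_assoc', div_le_iff₀ hx0]
          have : (D - 1) * x = D * (x - x / D) := by field_simp
          rw [this]
          exact mul_le_mul_of_nonneg_left hxD.le hD0.le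
        have h4 := mul_le_mul_of_nonneg_left hl hD0.le
        linarith
    · rw [if_neg hy.not_ge]
      have hy0 : 0 < y := hD0.trans hy
      have h3 : Real.log (y / D) ≤ Real.log (x / D) - 1 / D := by
        rw [Real.log_div hy0.ne' hD0.ne', Real.log_div hx0.ne' hD0.ne']
        have h4 := Real.log_le_sub_one_of_pos (div_pos hy0 hx0)
        rw [Real.log_div hy0.ne' hx0.ne'] at h4
        have h5 : y / x ≤ 1 - 1 / D := by
          rw [div_le_iff₀ hx0]
          have : (1 - 1 / D) * x = x - x / D := by ring
          linarith
        linarith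
      have h4 := mul_le_mul_of_nonneg_left h3 hD0.le
      have h5 : D * (1 / D) = 1 := by field_simp
      linarith

theorem nonpos_of_decayTime_nonpos {D x : ℝ} (hD : 1 ≤ D) (h : decayTime D x ≤ 0) : x ≤ 0 := by
  unfold decayTime at h
  split_ifs at h with hx
  · exact h
  · have : 0 ≤ Real.log (x / D) := Real.log_nonneg (by rw [le_div_iff₀] <;> linarith)
    nlinarith

theorem decayTime_le {D x X : ℝ} (hD : 1 ≤ D) (hX : 1 ≤ X) (h : x ≤ D * X) :
    decayTime D x ≤ D * (1 + Real.log X) := by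
  unfold decayTime
  have := Real.log_nonneg hX
  split_ifs with hx
  · nlinarith
  · refine mul_le_mul_of_nonneg_left (add_le_add_right (Real.log_le_log ?_ ?_) _) (by linarith)
    · exact div_pos (by linarith) (by linarith)
    · rw [div_le_iff₀ (by linarith), mul_comm]; exact h

/-- An upper bound for the accumulators with threshold `q ^ 64`. -/
def accBound (q : ℕ) : ℕ := if q = 2 then 2 ^ 64 else q ^ 65

theorem pow_le_accBound {q : ℕ} (hq : 2 ≤ q) : q ^ 64 ≤ accBound q := by
  unfold accBound
  split_ifs with h
  · rw [h]
  · exact Nat.pow_le_pow_right (by omega) (by norm_num)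

/-- For q = 2 every jump is 1 or 2. Hence accumulators cannot overshoot 2^64, which matters because
the number of rounds has no slack at q = 2, n = 1. -/
theorem peelRound_iterate_two_pow {q m : ℕ} {C : Submodule (ZMod q) (Fin m → ZMod q)} (hq : q = 2) (Q R : ℕ)
    (e : Fin m) :
    ∃ t, (peelRound C Q)^[R] (fun _ => 1) e = 2 ^ t := by
  induction R with
  | zero => exact ⟨0, rfl⟩
  | succ R ih =>
    obtain ⟨t, ht⟩ := ih
    rw [Function.iterate_succ_apply', peelRound, ht]
    split_ifs
    · have hj := jump_dvd (C := C)
        ((activeSet Q ((peelRound C Q)^[R] fun _ => 1)).filter (e < ·)) e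
      replace hj := hj.trans (Dvd.intro_left 1 (by rw [hq, one_mul, pow_one]) : q ∣ 2 ^ 1)
      obtain ⟨s, -, hs⟩ := (Nat.dvd_prime_pow Nat.prime_two).1 hj
      exact ⟨t + s, by rw [hs, pow_add]⟩
    · exact ⟨t, rfl⟩

/-! ### Every extremal set is removed by the peeling process -/

section Covering

variable {q m : ℕ} [NeZero q] {C : Submodule (ZMod q) (Fin m → ZMod q)} {S : Finset (Fin m)} {d : ℕ}

/-- The left side telescopes into jumps relative to Sᶜ together with the later elements of S ∩
active. That set contains all later active coordinates, so the jumps in the peeling process are at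
least as large. -/
theorem logb_jump_gain {Q : ℕ} (acc : Fin m → ℕ) :
    Real.logb 2 (Nat.card (vanishingOn C Sᶜ)) -
      Real.logb 2 (Nat.card (vanishingOn C (Sᶜ ∪ S ∩ activeSet Q acc))) ≤
    ∑ e ∈ S ∩ activeSet Q acc,
      Real.logb 2 (jump C ((activeSet Q acc).filter (e < ·)) e) := by
  set B := S ∩ activeSet Q acc with hB
  have hp : ∀ A, (Nat.card (vanishingOn C A) : ℝ) ≠ 0 := fun A => by
    exact_mod_cast (card_vanishingOn_pos A).ne'
  have hj : ∀ A e, (jump C A e : ℝ) ≠ 0 := fun A e => by exact_mod_cast (jump_pos A e).ne'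
  have h1 := prod_jump_mul_card (C := C) Sᶜ B
  have h2 : Real.logb 2 (Nat.card (vanishingOn C Sᶜ)) =
      ∑ e ∈ B, Real.logb 2 (jump C (Sᶜ ∪ B.filter (e < ·)) e) +
        Real.logb 2 (Nat.card (vanishingOn C (Sᶜ ∪ B))) := by
    rw [← h1, Nat.cast_mul, Nat.cast_prod, Real.logb_mul _ (hp _), Real.logb_prod]
    · exact fun e _ => hj _ _
    · exact Finset.prod_ne_zero_iff.2 fun e _ => hj _ _
  rw [h2, add_sub_cancel_right]
  refine Finset.sum_le_sum fun e _ => Real.logb_le_logb_of_le one_lt_two ?_ ?_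
  · exact_mod_cast jump_pos _ _
  · refine Nat.cast_le.2 (jump_anti (fun i hi => ?_) e)
    simp only [hB, Finset.mem_union, Finset.mem_compl, Finset.mem_filter, Finset.mem_inter] at hi ⊢
    tauto

theorem max_le_logb_jump_gain (hS : IsExtremal C d S) (hd : 1 ≤ d) {Q : ℕ} (acc : Fin m → ℕ)
    (hne : (S ∩ activeSet Q acc).Nonempty) :
    1 ≤ ∑ e ∈ S ∩ activeSet Q acc, Real.logb 2 (jump C ((activeSet Q acc).filter (e < ·)) e) ∧
    ((S ∩ activeSet Q acc).card : ℝ) ≤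
      d * ∑ e ∈ S ∩ activeSet Q acc, Real.logb 2 (jump C ((activeSet Q acc).filter (e < ·)) e) := by
  have hgain := logb_jump_gain (C := C) (S := S) (Q := Q) acc
  have hcard := hS.card_le_of_subset (A := S ∩ activeSet Q acc) Finset.inter_subset_left
  have hd' : (1 : ℝ) ≤ d := by exact_mod_cast hd
  have h2 := hcard.trans (mul_le_mul_of_nonneg_left hgain (by linarith))
  refine ⟨?_, h2⟩
  have hpos : 0 < ((S ∩ activeSet Q acc).card : ℝ) := by exact_mod_cast Finset.card_pos.2 hne
  have h3 := pos_of_mul_pos_right (hpos.trans_le h2) (by linarith)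
  have hj : ∀ A e, (jump C A e : ℝ) ≠ 0 := fun A e => by exact_mod_cast (jump_pos A e).ne'
  rw [← Real.logb_prod _ _ fun e _ => hj _ _, ← Nat.cast_prod] at h3 ⊢
  -- A positive gain is the logarithm of an integer greater than 1, hence at least 1 bit.
  have h4 : 1 < ∏ e ∈ S ∩ activeSet Q acc, jump C ((activeSet Q acc).filter (e < ·)) e := by
    by_contra hle
    have := Real.logb_nonpos (b := 2) one_lt_two (x := ((∏ e ∈ S ∩ activeSet Q acc,
      jump C ((activeSet Q acc).filter (e < ·)) e : ℕ) : ℝ)) (by positivity)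
      (by exact_mod_cast not_lt.1 hle)
    linarith
  rw [Real.le_logb_iff_rpow_le one_lt_two (by positivity), Real.rpow_one]
  exact_mod_cast h4

/-- The last multiplication starts below q^64 and has a factor of at most q. For q = 2 it starts at
2^63 or less. -/
theorem peelRound_iterate_le_accBound (hq : 2 ≤ q) (R : ℕ) (e : Fin m) :
    (peelRound C (q ^ 64))^[R] (fun _ => 1) e ≤ accBound q := by
  induction R with
  | zero =>
    unfold accBound
    split_ifs
    · exact Nat.one_le_two_pow
    · exact Nat.one_le_pow _ _ (by omega)
  | succ R ih =>
    rw [Function.iterate_succ_apply', peelRound]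
    split_ifs with hlt
    · have hj := Nat.le_of_dvd (NeZero.pos q) (jump_dvd (C := C) ((activeSet (q ^ 64)
        ((peelRound C (q ^ 64))^[R] fun _ => 1)).filter (e < ·)) e)
      unfold accBound
      split_ifs with h2
      · obtain ⟨t, ht⟩ := peelRound_iterate_two_pow (C := C) h2 (q ^ 64) R e
        rw [ht, h2, Nat.pow_lt_pow_iff_right (by norm_num)] at hlt
        calc _ ≤ 2 ^ 63 * 2 := Nat.mul_le_mul (ht ▸ Nat.pow_le_pow_right two_pos (by omega)) (by omega)
          _ = 2 ^ 64 := by norm_num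
      · rw [pow_succ]
        exact Nat.mul_le_mul hlt.le hj
    · exact ih

theorem IsExtremal.subset_removed (hS : IsExtremal C d S) {n R : ℕ} (hq : 2 ≤ q) (hn : 1 ≤ n)
    (hd : 1 ≤ d) (hC : Nat.card C ≤ q ^ n)
    (hR : Real.logb 2 (accBound q) * d * (1 + Real.log (n * Real.logb 2 q)) ≤ R) :
    S ⊆ (activeSet (q ^ 64) ((peelRound C (q ^ 64))^[R] fun _ => 1))ᶜ := by
  set acc : ℕ → Fin m → ℕ := fun i => (peelRound C (q ^ 64))^[i] fun _ => 1 with hacc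
  have hsucc : ∀ i, acc (i + 1) = peelRound C (q ^ 64) (acc i) := fun i =>
    Function.iterate_succ_apply' _ _ _
  set Λ := Real.logb 2 (accBound q) with hΛ
  have hd' : (1 : ℝ) ≤ d := by exact_mod_cast hd
  have hl : 1 ≤ Real.logb 2 q := by
    rw [Real.le_logb_iff_rpow_le one_lt_two (by positivity), Real.rpow_one]; exact_mod_cast hq
  have hΛ1 : 1 ≤ Λ := by
    rw [hΛ, Real.le_logb_iff_rpow_le one_lt_two, Real.rpow_one]
    · exact_mod_cast (hq.trans (Nat.le_self_pow (by norm_num) q)).trans (pow_le_accBound hq)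
    · exact_mod_cast (Nat.pow_pos (NeZero.pos q)).trans_le (pow_le_accBound hq)
  have hpos : ∀ i e, (0 : ℝ) < acc i e := fun i e => by
    exact_mod_cast one_le_peelRound_iterate (C := C) (Q := q ^ 64) i e
  have hle : ∀ i e, Real.logb 2 (acc i e) ≤ Λ := fun i e =>
    Real.logb_le_logb_of_le one_lt_two (hpos i e)
      (by exact_mod_cast peelRound_iterate_le_accBound hq i e)
  have hnn : ∀ i e, 0 ≤ Real.logb 2 (acc i e) := fun i e =>
    Real.logb_nonneg one_lt_two (by exact_mod_cast one_le_peelRound_iterate (C := C) (Q := q ^ 64) i e)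
  set B : ℕ → Finset (Fin m) := fun i => S ∩ activeSet (q ^ 64) (acc i) with hB
  have hBsucc : ∀ i, B (i + 1) ⊆ B i := fun i => by
    simp only [hB, hsucc]
    exact Finset.inter_subset_inter_left (activeSet_peelRound_subset _)
  by_contra hcon
  have hne : (B R).Nonempty := by
    by_contra hemp
    refine hcon fun e he => Finset.mem_compl.2 fun h => hemp ⟨e, Finset.mem_inter.2 ⟨he, h⟩⟩
  have hne' : ∀ i ≤ R, (B i).Nonempty := fun i hi =>
    hne.mono (antitone_nat_of_succ_le (f := B) hBsucc hi)
  -- The potential: bits still missing from the accumulators of the active part of S. It is at most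
  -- Λ|B i|, while a round gains at least |B i|/d, whence the decay rate 1/(Λd).
  set Φ : ℕ → ℝ := fun i => ∑ e ∈ B i, (Λ - Real.logb 2 (acc i e)) with hΦ
  have hstep : ∀ i ≤ R, Φ (i + 1) ≤ Φ i - 1 ∧ Φ (i + 1) ≤ Φ i - Φ i / (Λ * d) := by
    intro i hi
    obtain ⟨h1, h2⟩ := max_le_logb_jump_gain hS hd (acc i) (hne' i hi)
    set G := ∑ e ∈ S ∩ activeSet (q ^ 64) (acc i),
      Real.logb 2 (jump C ((activeSet (q ^ 64) (acc i)).filter (e < ·)) e) with hG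
    have h3 : Φ (i + 1) ≤ Φ i - G := by
      calc Φ (i + 1) ≤ ∑ e ∈ B i, (Λ - Real.logb 2 (acc (i + 1) e)) :=
            Finset.sum_le_sum_of_subset_of_nonneg (hBsucc i) fun e _ _ => sub_nonneg.2 (hle _ e)
        _ = ∑ e ∈ B i, ((Λ - Real.logb 2 (acc i e)) -
              Real.logb 2 (jump C ((activeSet (q ^ 64) (acc i)).filter (e < ·)) e)) := by
            refine Finset.sum_congr rfl fun e he => ?_
            have hlt := mem_activeSet.1 (Finset.mem_inter.1 he).2
            rw [hsucc, peelRound, if_pos hlt, Nat.cast_mul, Real.logb_mul (hpos i e).ne'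
              (by exact_mod_cast (jump_pos _ _).ne')]
            ring
        _ = Φ i - G := Finset.sum_sub_distrib _ _
    have h4 : Φ i ≤ Λ * (B i).card := by
      rw [mul_comm, ← nsmul_eq_mul]
      exact Finset.sum_le_card_nsmul _ _ _ fun e _ => by linarith [hnn i e]
    refine ⟨by linarith, ?_⟩
    have h5 : Φ i / (Λ * d) ≤ G := by
      rw [div_le_iff₀ (by positivity)]
      calc Φ i ≤ Λ * (B i).card := h4
        _ ≤ Λ * (d * G) := mul_le_mul_of_nonneg_left h2 (by linarith)
        _ = G * (Λ * d) := by ring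
    linarith
  have hD : 1 ≤ Λ * d := by nlinarith
  have hdecay : ∀ i ≤ R, decayTime (Λ * d) (Φ i) ≤ decayTime (Λ * d) (Φ 0) - i := by
    intro i
    induction i with
    | zero => simp
    | succ i ih =>
      intro hi
      have h1 := ih (by omega)
      have h2 := hstep i (by omega)
      have h3 := decayTime_step hD h2.1 h2.2
      push_cast
      linarith
  have hX : 1 ≤ n * Real.logb 2 q := by
    have : (1 : ℝ) ≤ n := by exact_mod_cast hn
    nlinarith
  have h0 : Φ 0 ≤ Λ * d * (n * Real.logb 2 q) := by
    have h1 : Φ 0 ≤ (B 0).card • Λ :=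
      Finset.sum_le_card_nsmul _ _ _ fun e _ => by linarith [hnn 0 e]
    have h2 : ((B 0).card : ℝ) ≤ S.card := by
      exact_mod_cast Finset.card_le_card Finset.inter_subset_left
    have h3 := mul_le_mul_of_nonneg_left (logb_card_vanishingOn_le hC Sᶜ) (by linarith : (0 : ℝ) ≤ d)
    have h4 := h2.trans (hS.card_le.trans h3)
    rw [nsmul_eq_mul] at h1
    have h5 := mul_le_mul_of_nonneg_left h4 (by linarith : (0 : ℝ) ≤ Λ)
    linarith
  have hfin := hdecay R le_rfl
  have hinit := decayTime_le hD hX h0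
  have hR0 : Φ R ≤ 0 := nonpos_of_decayTime_nonpos hD (by linarith)
  -- An active accumulator is strictly below q^64 ≤ `accBound q`, so a nonempty active part has
  -- positive potential.
  have hRpos : 0 < Φ R := Finset.sum_pos (fun e he => by
    have hlt := mem_activeSet.1 (Finset.mem_inter.1 he).2
    have : Real.logb 2 (acc R e) < Λ :=
      Real.logb_lt_logb one_lt_two (hpos R e)
        (by exact_mod_cast hlt.trans_le (pow_le_accBound hq))
    linarith) hne
  linarith

end Covering

/-! ### The number of rounds -/

/-- The number of rounds of the algorithm. -/
def roundCount (q n d : ℕ) : ℕ := Nat.log 2 ((n * q) ^ (Nat.log 2 (q ^ 64) * d))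

theorem natLog_two_le_logb {x : ℕ} (hx : x ≠ 0) : (Nat.log 2 x : ℝ) ≤ Real.logb 2 x := by
  rw [Real.le_logb_iff_rpow_le one_lt_two (by positivity), Real.rpow_natCast]
  exact_mod_cast Nat.pow_log_le_self 2 hx

theorem logb_le_natLog_two_add_one {x : ℕ} (hx : x ≠ 0) : Real.logb 2 x ≤ Nat.log 2 x + 1 := by
  rw [Real.logb_le_iff_le_rpow one_lt_two (by positivity)]
  exact_mod_cast (Nat.lt_pow_succ_log_self one_lt_two x).le

theorem roundCount_le {q n d : ℕ} (hq : 2 ≤ q) (hn : 1 ≤ n) :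
    (roundCount q n d : ℝ) ≤ 64 * (d * Real.logb 2 q * (Real.logb 2 n + Real.logb 2 q)) := by
  have hn' : (1 : ℝ) ≤ n := by exact_mod_cast hn
  have hq' : (2 : ℝ) ≤ q := by exact_mod_cast hq
  have h1 := natLog_two_le_logb (x := q ^ 64) (by positivity)
  have h2 := natLog_two_le_logb (x := (n * q) ^ (Nat.log 2 (q ^ 64) * d)) (by positivity)
  push_cast at h1 h2
  rw [Real.logb_pow] at h1 h2
  rw [Real.logb_mul (by positivity) (by positivity)] at h2
  have h3 : 0 ≤ Real.logb 2 n + Real.logb 2 q :=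
    add_nonneg (Real.logb_nonneg one_lt_two hn') (Real.logb_nonneg one_lt_two (by linarith))
  push_cast at h1 h2
  calc (roundCount q n d : ℝ) ≤ _ := h2
    _ ≤ (64 * Real.logb 2 q * d) * (Real.logb 2 n + Real.logb 2 q) := by gcongr
    _ = _ := by ring

theorem log_two_mul_logb (x : ℝ) : Real.log 2 * Real.logb 2 x = Real.log x := by
  rw [Real.logb, mul_div_cancel₀ _ (Real.log_pos one_lt_two).ne']

/-- At n = 1 both sides equal 64d. For n ≥ 2 the gap between natural and binary logarithm absorbs
the rounding loss of 1. -/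
theorem le_roundCount_of_eq_two {n d : ℕ} (hn : 1 ≤ n) (hd : 1 ≤ d) :
    64 * d * (1 + Real.log n) ≤ roundCount 2 n d := by
  have e64 : Nat.log 2 (2 ^ 64) = 64 := Nat.log_pow one_lt_two 64
  have hd' : (1 : ℝ) ≤ d := by exact_mod_cast hd
  rw [roundCount, e64]
  rcases hn.eq_or_lt with rfl | hn2
  · rw [one_mul, Nat.log_pow one_lt_two]
    simp
  · have hn2' : (2 : ℝ) ≤ n := by exact_mod_cast hn2
    have h2 := logb_le_natLog_two_add_one (x := (n * 2) ^ (64 * d)) (by positivity)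
    push_cast at h2
    rw [Real.logb_pow, Real.logb_mul (by positivity) (by positivity),
      Real.logb_self_eq_one one_lt_two] at h2
    push_cast at h2
    have h3 := log_two_mul_logb n
    have h4 : 1 ≤ Real.logb 2 n := by
      rw [Real.le_logb_iff_rpow_le one_lt_two (by positivity), Real.rpow_one]; exact hn2'
    have h5 := Real.log_two_lt_d9
    have h6 : Real.log n + 1 / 64 ≤ Real.logb 2 n := by nlinarith
    nlinarith

/-- The overshoot 65/64 and both roundings are paid for by the factor 21/20 between log n + log q
and 1 + ln(n log q). That factor needs log q ≥ 11/7, which holds since 3^7 ≥ 2^11. -/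
theorem le_roundCount_of_three_le {q n d : ℕ} (hq : 3 ≤ q) (hn : 1 ≤ n) (hd : 1 ≤ d) :
    65 * Real.logb 2 q * d * (1 + Real.log (n * Real.logb 2 q)) ≤ roundCount q n d := by
  have hn' : (1 : ℝ) ≤ n := by exact_mod_cast hn
  have hq' : (3 : ℝ) ≤ q := by exact_mod_cast hq
  have hd' : (1 : ℝ) ≤ d := by exact_mod_cast hd
  have h1 := logb_le_natLog_two_add_one (x := q ^ 64) (by positivity)
  have h2 := logb_le_natLog_two_add_one (x := (n * q) ^ (Nat.log 2 (q ^ 64) * d)) (by positivity)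
  push_cast at h1 h2
  rw [Real.logb_pow] at h1 h2
  rw [Real.logb_mul (by positivity) (by positivity)] at h2
  push_cast at h1 h2
  change _ ≤ (roundCount q n d : ℝ) + 1 at h2
  set l := Real.logb 2 q with hl
  have hl1 : 11 / 7 ≤ l := by
    have h7 : (11 : ℕ) ≤ Real.logb 2 ((q : ℝ) ^ 7) := by
      rw [Real.le_logb_iff_rpow_le one_lt_two (by positivity), Real.rpow_natCast]
      calc (2 : ℝ) ^ 11 ≤ 3 ^ 7 := by norm_num
        _ ≤ (q : ℝ) ^ 7 := pow_le_pow_left₀ (by norm_num) hq' 7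
    rw [Real.logb_pow] at h7
    push_cast at h7
    linarith
  have hlog2 := Real.log_two_lt_d9
  have hlog2' := Real.log_two_gt_d9
  have hnn : 0 ≤ Real.logb 2 n := Real.logb_nonneg one_lt_two hn'
  have hlogn := log_two_mul_logb n
  have hlogl : Real.log l ≤ l / 2 + Real.log 2 - 1 := by
    have := Real.log_le_sub_one_of_pos (x := l / 2) (by positivity)
    rw [Real.log_div (by positivity) two_ne_zero] at this
    linarith
  have hY1 : 1 ≤ 1 + Real.log (n * l) := by
    have := Real.log_nonneg (x := n * l) (by nlinarith)
    linarith
  have hXY : 21 / 20 * (1 + Real.log (n * l)) ≤ Real.logb 2 n + l := by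
    rw [Real.log_mul (by positivity) (by positivity)]
    nlinarith
  set X := Real.logb 2 n + l
  set Y := 1 + Real.log (n * l)
  have ha : 64 * l - 1 ≤ (Nat.log 2 (q ^ 64) : ℝ) := by linarith
  have h3 : (64 * l - 1) * d * X ≤ (Nat.log 2 (q ^ 64) : ℝ) * d * X := by
    have : 0 ≤ X := by linarith
    gcongr
  have h4 : (64 * l - 1) * d * (21 / 20 * Y) ≤ (64 * l - 1) * d * X :=
    mul_le_mul_of_nonneg_left hXY (by nlinarith)
  -- The coefficient is (64l - 1)·21/20 - 65l, the surplus left for the outer rounding.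
  have h5 : 1 ≤ (11 / 5 * l - 21 / 20) * (d * Y) := by
    have : 1 ≤ d * Y := one_le_mul_of_one_le_of_one_le hd' hY1
    nlinarith
  nlinarith

theorem le_roundCount {q n d : ℕ} (hq : 2 ≤ q) (hn : 1 ≤ n) (hd : 1 ≤ d) :
    Real.logb 2 (accBound q) * d * (1 + Real.log (n * Real.logb 2 q)) ≤ roundCount q n d := by
  unfold accBound
  split_ifs with h
  · subst h
    rw [Nat.cast_pow, Nat.cast_ofNat, Real.logb_pow, Real.logb_self_eq_one one_lt_two]
    simpa using le_roundCount_of_eq_two hn hd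
  · push_cast
    rw [Real.logb_pow]
    exact_mod_cast le_roundCount_of_three_le (by omega) hn hd

/-! ### Reasoning about programs -/

@[simp] theorem Memory.write_apply (M : Memory) (b i v b' i' : ℕ) :
    M.write b i v b' i' = if b' = b ∧ i' = i then v else M b' i' := by
  unfold Memory.write
  by_cases hb : b' = b
  · subst hb
    by_cases hi : i' = i
    · subst hi; simp
    · simp [hi]
  · simp [hb]

/-- The number of nodes of an expression. -/
def Expr.nodes : Expr → ℕ
  | .const _ => 1
  | .read _ i => i.nodes + 1
  | .op _ e₁ e₂ => e₁.nodes + e₂.nodes + 1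

/-- All numbers created by evaluating the expression are at most `X`. -/
def Expr.Fits (X : ℕ) (M : Memory) : Expr → Prop
  | .const c => c ≤ X
  | .read _ i => i.Fits X M
  | .op .add e₁ e₂ => e₁.Fits X M ∧ e₂.Fits X M ∧ e₁.eval M + e₂.eval M ≤ X
  | .op .mul e₁ e₂ => e₁.Fits X M ∧ e₂.Fits X M ∧ e₁.eval M * e₂.eval M ≤ X
  | .op _ e₁ e₂ => e₁.Fits X M ∧ e₂.Fits X M

/-- The content of the scalar variable `x`, kept in cell `x` of bank `0`. -/
abbrev Expr.var (x : ℕ) : Expr := .read 0 (.const x)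

theorem Expr.Fits.subexpressions {X : ℕ} {M : Memory} {o : ArithOp} {e₁ e₂ : Expr}
    (h : (Expr.op o e₁ e₂).Fits X M) : e₁.Fits X M ∧ e₂.Fits X M := by
  cases o
  · exact ⟨h.1, h.2.1⟩
  · exact h
  · exact ⟨h.1, h.2.1⟩
  · exact h
  · exact h

/-- Truncated difference, quotient and remainder never exceed the left operand, so `Expr.Fits`
restricts only constants, sums and products. -/
theorem Expr.Fits.eval_le {X : ℕ} {M : Memory} (hM : ∀ b i, M b i ≤ X) :
    ∀ {e : Expr}, e.Fits X M → e.eval M ≤ X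
  | .const _, h => h
  | .read _ _, _ => hM _ _
  | .op .add _ _, h => h.2.2
  | .op .mul _ _, h => h.2.2
  | .op .sub _ _, h => (Nat.sub_le _ _).trans (Expr.Fits.eval_le hM h.1)
  | .op .div _ _, h => (Nat.div_le_self _ _).trans (Expr.Fits.eval_le hM h.1)
  | .op .mod _ _, h => (Nat.mod_le _ _).trans (Expr.Fits.eval_le hM h.1)

theorem Expr.Fits.cost_le {X : ℕ} {M : Memory} (hM : ∀ b i, M b i ≤ X) :
    ∀ {e : Expr}, e.Fits X M → e.cost M ≤ e.nodes * (1 + Nat.size X) ^ 2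
  | .const c, h => by
    have := Nat.size_le_size (show c ≤ X from h)
    simp only [Expr.cost, Expr.nodes]
    nlinarith
  | .read b i, h => by
    have h1 := Expr.Fits.cost_le hM (e := i) h
    have h2 := Nat.size_le_size (Expr.Fits.eval_le hM (e := i) h)
    have h3 := Nat.size_le_size (hM b (i.eval M))
    simp only [Expr.cost, Expr.nodes]
    nlinarith
  | .op o e₁ e₂, h => by
    have h1 := Expr.Fits.cost_le hM h.subexpressions.1
    have h2 := Expr.Fits.cost_le hM h.subexpressions.2
    have h3 := Nat.size_le_size (Expr.Fits.eval_le hM h.subexpressions.1)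
    have h4 := Nat.size_le_size (Expr.Fits.eval_le hM h.subexpressions.2)
    have h5 : (1 + Nat.size (e₁.eval M)) * (1 + Nat.size (e₂.eval M)) ≤ (1 + Nat.size X) ^ 2 := by
      rw [sq]; exact Nat.mul_le_mul (by omega) (by omega)
    simp only [Expr.cost, Expr.nodes]
    linarith

/-- A bound for the cost of one step of a program with small expressions and numbers up to `X`. -/
def stepCost (X : ℕ) : ℕ := 40 * (1 + Nat.size X) ^ 2

/-- If all cells of `M` are at most `X`, then `c` transforms `M` into `M'` within `s` steps, and
all cells of `M'` are at most `X`. -/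
def Program.Steps (X : ℕ) (c : Program) (M M' : Memory) (s : ℕ) : Prop :=
  (∀ b i, M b i ≤ X) → (∃ t, c.Run M M' t ∧ t ≤ s * stepCost X) ∧ ∀ b i, M' b i ≤ X

namespace Program.Steps

variable {X : ℕ} {M M' M'' : Memory} {s s₁ s₂ : ℕ} {c c₁ c₂ : Program} {e : Expr}

theorem mono (h : c.Steps X M M' s₁) (hs : s₁ ≤ s₂) : c.Steps X M M' s₂ := fun hM =>
  ⟨let ⟨t, ht, hle⟩ := (h hM).1; ⟨t, ht, hle.trans (Nat.mul_le_mul_right _ hs)⟩, (h hM).2⟩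

theorem guard_cost_le (hM : ∀ b i, M b i ≤ X) (he : e.Fits X M) (hn : e.nodes < 40) :
    e.cost M + 1 ≤ stepCost X := by
  have h1 := he.cost_le hM
  have h2 : e.nodes * (1 + Nat.size X) ^ 2 ≤ 39 * (1 + Nat.size X) ^ 2 :=
    Nat.mul_le_mul_right _ (by omega)
  have h3 : 1 ≤ (1 + Nat.size X) ^ 2 := Nat.one_le_pow _ _ (by omega)
  unfold stepCost
  omega

theorem skip (X : ℕ) (M : Memory) : Program.skip.Steps X M M 1 := fun hM =>
  ⟨⟨1, .skip M, by
    have h3 : 1 ≤ (1 + Nat.size X) ^ 2 := Nat.one_le_pow _ _ (by omega)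
    unfold stepCost
    omega⟩, hM⟩

theorem assign {b : ℕ} {i : Expr} (hi : i.Fits X M) (he : e.Fits X M)
    (hn : i.nodes + e.nodes < 40) :
    (Program.assign b i e).Steps X M (M.write b (i.eval M) (e.eval M)) 1 := by
  intro hM
  have h1 := hi.cost_le hM
  have h2 := he.cost_le hM
  have h3 := Nat.size_le_size (hi.eval_le hM)
  have h4 := Nat.size_le_size (he.eval_le hM)
  refine ⟨⟨_, .assign M b i e, ?_⟩, fun b' i' => ?_⟩
  · have h5 : (i.nodes + e.nodes) * (1 + Nat.size X) ^ 2 ≤ 39 * (1 + Nat.size X) ^ 2 :=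
      Nat.mul_le_mul_right _ (by omega)
    unfold stepCost
    nlinarith
  · rw [Memory.write_apply]
    split_ifs
    · exact he.eval_le hM
    · exact hM _ _

theorem seq (h₁ : c₁.Steps X M M' s₁) (h₂ : c₂.Steps X M' M'' s₂) :
    (Program.seq c₁ c₂).Steps X M M'' (s₁ + s₂) := by
  intro hM
  obtain ⟨⟨t₁, r₁, l₁⟩, hM'⟩ := h₁ hM
  obtain ⟨⟨t₂, r₂, l₂⟩, hM''⟩ := h₂ hM'
  exact ⟨⟨_, .seq r₁ r₂, by rw [add_mul]; omega⟩, hM''⟩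

theorem cond_true (h0 : e.eval M ≠ 0) (he : e.Fits X M) (hn : e.nodes < 40)
    (h : c₁.Steps X M M' s) : (Program.cond e c₁ c₂).Steps X M M' (1 + s) := by
  intro hM
  obtain ⟨⟨t, r, l⟩, hM'⟩ := h hM
  have := guard_cost_le hM he hn
  exact ⟨⟨_, .cond_true h0 r, by rw [add_mul]; omega⟩, hM'⟩

theorem cond_false (h0 : e.eval M = 0) (he : e.Fits X M) (hn : e.nodes < 40)
    (h : c₂.Steps X M M' s) : (Program.cond e c₁ c₂).Steps X M M' (1 + s) := by
  intro hM
  obtain ⟨⟨t, r, l⟩, hM'⟩ := h hM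
  have := guard_cost_le hM he hn
  exact ⟨⟨_, .cond_false h0 r, by rw [add_mul]; omega⟩, hM'⟩

theorem loop_true (h0 : e.eval M ≠ 0) (he : e.Fits X M) (hn : e.nodes < 40)
    (h₁ : c.Steps X M M' s₁) (h₂ : (Program.loop e c).Steps X M' M'' s₂) :
    (Program.loop e c).Steps X M M'' (1 + s₁ + s₂) := by
  intro hM
  obtain ⟨⟨t₁, r₁, l₁⟩, hM'⟩ := h₁ hM
  obtain ⟨⟨t₂, r₂, l₂⟩, hM''⟩ := h₂ hM'
  have := guard_cost_le hM he hn
  exact ⟨⟨_, .loop_true h0 r₁ r₂, by rw [add_mul, add_mul]; omega⟩, hM''⟩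

theorem loop_false (h0 : e.eval M = 0) (he : e.Fits X M) (hn : e.nodes < 40) :
    (Program.loop e c).Steps X M M 1 := by
  intro hM
  have := guard_cost_le hM he hn
  exact ⟨⟨_, .loop_false h0, by omega⟩, hM⟩

/-- A while loop with a loop invariant `I n` that is indexed by a bound `n` for the number of
iterations still to come. -/
theorem loop_of_invariant (I : ℕ → Memory → Prop) (hn : e.nodes < 40)
    (hfits : ∀ n M, I n M → e.Fits X M)
    (hstep : ∀ n M, I n M → e.eval M ≠ 0 → ∃ n' < n, ∃ M', c.Steps X M M' s ∧ I n' M')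
    {n : ℕ} (hI : I n M) :
    ∃ M', (Program.loop e c).Steps X M M' (n * (1 + s) + 1) ∧ e.eval M' = 0 ∧ ∃ n', I n' M' := by
  induction n using Nat.strong_induction_on generalizing M with
  | _ n ih =>
  by_cases h0 : e.eval M = 0
  · exact ⟨M, (loop_false h0 (hfits n M hI) hn).mono (by omega), h0, n, hI⟩
  · obtain ⟨n', hn', M', hc, hI'⟩ := hstep n M hI h0
    obtain ⟨M'', hl, h0', hI''⟩ := ih n' hn' hI'
    refine ⟨M'', (loop_true h0 (hfits n M hI) hn hc hl).mono ?_, h0', hI''⟩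
    have : (n' + 1) * (1 + s) ≤ n * (1 + s) := Nat.mul_le_mul_right _ hn'
    rw [add_mul] at this
    omega

end Program.Steps

/-- `for x = N - 1, ..., 0 do c`. -/
def Program.countdown (x : ℕ) (N : Expr) (c : Program) : Program :=
  .seq (.assign 0 (.const x) N)
    (.loop (.var x) (.seq (.assign 0 (.const x) (.op .sub (.var x) (.const 1))) c))

/-- The counter is decremented before the body runs: the body sees the value i while the invariant
is still `I (i + 1)`. Hence invariants must survive writes to the counter. -/
theorem Program.Steps.countdown {X x s : ℕ} {N : Expr} {c : Program} (I : ℕ → Memory → Prop)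
    (hx : x ≤ X) (hX : 1 ≤ X) {M : Memory} (hN : N.Fits X M) (hnN : N.nodes < 39)
    (hI : ∀ i M v, I i M → I i (M.write 0 x v))
    (hstep : ∀ i < N.eval M, ∀ M', M' 0 x = i → I (i + 1) M' →
      ∃ M'', c.Steps X M' M'' s ∧ M'' 0 x = i ∧ I i M'')
    (h0 : I (N.eval M) M) :
    ∃ M', (Program.countdown x N c).Steps X M M' (N.eval M * (2 + s) + 2) ∧ I 0 M' := by
  have h1 := Program.Steps.assign (b := 0) (M := M) (i := .const x) (e := N) hx hN
    (by simp only [Expr.nodes]; omega)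
  obtain ⟨M', h2, h3, n', -, h4, h5⟩ := Program.Steps.loop_of_invariant (X := X) (s := 1 + s)
    (e := .var x) (c := .seq (.assign 0 (.const x) (.op .sub (.var x) (.const 1))) c)
    (fun n M' => n ≤ N.eval M ∧ M' 0 x = n ∧ I n M') (by simp [Expr.nodes]) (fun _ _ _ => hx)
    (fun n M' h h0 => by
      obtain ⟨hle, hn, hIn⟩ := h
      have hn0 : n ≠ 0 := fun h => h0 (by simpa [Expr.eval, hn] using h)
      have ha := Program.Steps.assign (X := X) (b := 0) (M := M') (i := .const x)
        (e := .op .sub (.var x) (.const 1)) hx ⟨hx, hX⟩ (by simp [Expr.nodes])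
      have he : (Expr.op .sub (.var x) (.const 1)).eval M' = n - 1 := by
        simp [Expr.eval, ArithOp.apply, hn]
      rw [he] at ha
      obtain ⟨M'', hc, hx'', hI''⟩ := hstep (n - 1) (by omega) (M'.write 0 x (n - 1)) (by simp)
        (by rw [Nat.sub_add_cancel (by omega)]; exact hI _ _ _ hIn)
      exact ⟨n - 1, by omega, M'', ha.seq hc, by omega, hx'', hI''⟩)
    (M := M.write 0 x (N.eval M)) (n := N.eval M) ⟨le_rfl, by simp, hI _ _ _ h0⟩
  have h6 : n' = 0 := by rw [← h4]; exact h3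
  subst h6
  exact ⟨M', (h1.seq h2).mono (by ring_nf; omega), h5⟩

/-- `M` and `M'` agree on the scalar variables below `lo` and on the banks other than `0` that
are not listed in `bs`. -/
def Agree (lo : ℕ) (bs : List ℕ) (M M' : Memory) : Prop :=
  (∀ x < lo, M' 0 x = M 0 x) ∧ ∀ b, b ≠ 0 → b ∉ bs → ∀ i, M' b i = M b i

namespace Agree

variable {lo lo' : ℕ} {bs bs' : List ℕ} {M M' M'' : Memory}

theorem refl (lo : ℕ) (bs : List ℕ) (M : Memory) : Agree lo bs M M :=
  ⟨fun _ _ => rfl, fun _ _ _ _ => rfl⟩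

theorem trans (h : Agree lo bs M M') (h' : Agree lo bs M' M'') : Agree lo bs M M'' :=
  ⟨fun x hx => (h'.1 x hx).trans (h.1 x hx),
    fun b hb hbs i => (h'.2 b hb hbs i).trans (h.2 b hb hbs i)⟩

theorem mono (h : Agree lo' bs' M M') (hlo : lo ≤ lo') (hbs : bs' ⊆ bs) : Agree lo bs M M' :=
  ⟨fun x hx => h.1 x (by omega), fun b hb hb' => h.2 b hb fun hmem => hb' (hbs hmem)⟩

theorem write_scalar (h : Agree lo bs M M') {x v : ℕ} (hx : lo ≤ x) :
    Agree lo bs M (M'.write 0 x v) :=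
  ⟨fun y hy => by rw [Memory.write_apply, if_neg (by omega), h.1 y hy],
    fun b hb hbs i => by rw [Memory.write_apply, if_neg (by omega), h.2 b hb hbs i]⟩

theorem write_bank (h : Agree lo bs M M') {b i v : ℕ} (hb : b ∈ bs) (h0 : b ≠ 0) :
    Agree lo bs M (M'.write b i v) :=
  ⟨fun y hy => by rw [Memory.write_apply, if_neg (by omega), h.1 y hy],
    fun b' hb' hbs i => by
      rw [Memory.write_apply, if_neg (fun hbi => hbs (by rw [hbi.1]; exact hb)), h.2 b' hb' hbs i]⟩

end Agree

/-! ### Column operations on a generating family -/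

section ColumnOperations

/-- The replacement of (v, h c) by (h c, v + s • h c) is invertible. -/
theorem span_insert_range_euclid {R W : Type*} [CommRing R] [AddCommGroup W] [Module R W]
    {ι : Type*} [DecidableEq ι] (v : W) (h : ι → W) (c : ι) (s : R) :
    Submodule.span R (insert (h c) (Set.range (Function.update h c (v + s • h c)))) =
      Submodule.span R (insert v (Set.range h)) := by
  apply le_antisymm
  · rw [Submodule.span_le]
    have hv : v ∈ Submodule.span R (insert v (Set.range h)) :=
      Submodule.subset_span (Set.mem_insert _ _)
    have hh : ∀ i, h i ∈ Submodule.span R (insert v (Set.range h)) := fun i =>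
      Submodule.subset_span (Set.mem_insert_of_mem _ ⟨i, rfl⟩)
    rintro x (rfl | ⟨i, rfl⟩)
    · exact hh c
    · by_cases hi : i = c
      · subst hi
        rw [Function.update_self]
        exact Submodule.add_mem _ hv (Submodule.smul_mem _ _ (hh _))
      · rw [Function.update_of_ne hi]
        exact hh i
  · rw [Submodule.span_le]
    have hc : h c ∈ Submodule.span R (insert (h c) (Set.range (Function.update h c (v + s • h c)))) :=
      Submodule.subset_span (Set.mem_insert _ _)
    have hh : ∀ i, Function.update h c (v + s • h c) i ∈
        Submodule.span R (insert (h c) (Set.range (Function.update h c (v + s • h c)))) := fun i =>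
      Submodule.subset_span (Set.mem_insert_of_mem _ ⟨i, rfl⟩)
    rintro x (rfl | ⟨i, rfl⟩)
    · have h1 := hh c
      rw [Function.update_self] at h1
      simpa using Submodule.sub_mem _ h1 (Submodule.smul_mem _ s hc)
    · by_cases hi : i = c
      · subst hi
        exact hc
      · have h1 := hh i
        rwa [Function.update_of_ne hi] at h1

variable {q m k : ℕ} [NeZero q]

/-- Only v is nonzero at e, so the values at e are the multiples of v e. -/
theorem jump_eq_addOrderOf {C : Submodule (ZMod q) (Fin m → ZMod q)} {A : Finset (Fin m)} {e : Fin m}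
    {v : Fin m → ZMod q} {h : Fin k → Fin m → ZMod q}
    (hspan : Submodule.span (ZMod q) (insert v (Set.range h)) = vanishingOn C A)
    (he : ∀ c, h c e = 0) : jump C A e = addOrderOf (v e) := by
  have h1 : (vanishingOn C A).map (LinearMap.proj e : (Fin m → ZMod q) →ₗ[ZMod q] ZMod q) =
      Submodule.span (ZMod q) {v e} := by
    rw [← hspan, Submodule.map_span, Set.image_insert_eq, Submodule.span_insert]
    change Submodule.span (ZMod q) {v e} ⊔ _ = _
    rw [sup_eq_left, Submodule.span_le]
    rintro x ⟨-, ⟨c, rfl⟩, rfl⟩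
    simp [he]
  rw [jump, h1, ← Nat.card_zmultiples]
  refine Nat.card_congr (Equiv.setCongr ?_)
  ext x
  simp only [SetLike.mem_coe, Submodule.mem_span_singleton, AddSubgroup.mem_zmultiples_iff]
  constructor
  · rintro ⟨a, rfl⟩
    exact ⟨a.val, by simp⟩
  · rintro ⟨a, rfl⟩
    exact ⟨a, by simp⟩

/-- A combination a v + y with y in the span of h vanishes at e exactly when the order of v e
divides a. So the number of generators does not grow. -/
theorem span_insert_addOrderOf_smul {C : Submodule (ZMod q) (Fin m → ZMod q)} {A : Finset (Fin m)}
    {e : Fin m} {v : Fin m → ZMod q} {h : Fin k → Fin m → ZMod q}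
    (hspan : Submodule.span (ZMod q) (insert v (Set.range h)) = vanishingOn C A)
    (he : ∀ c, h c e = 0) :
    Submodule.span (ZMod q) (insert (addOrderOf (v e) • v) (Set.range h)) =
      vanishingOn C (insert e A) := by
  have hmem : ∀ x, x ∈ vanishingOn C (insert e A) ↔ x ∈ vanishingOn C A ∧ x e = 0 := fun x => by
    simp only [mem_vanishingOn, Finset.forall_mem_insert]
    tauto
  have hh : ∀ c, h c ∈ vanishingOn C A := fun c => by
    rw [← hspan]
    exact Submodule.subset_span (Set.mem_insert_of_mem _ ⟨c, rfl⟩)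
  have hv : v ∈ vanishingOn C A := by
    rw [← hspan]
    exact Submodule.subset_span (Set.mem_insert _ _)
  have hzero : ∀ y ∈ Submodule.span (ZMod q) (Set.range h), y e = 0 := by
    have : Submodule.span (ZMod q) (Set.range h) ≤
        LinearMap.ker (LinearMap.proj e : (Fin m → ZMod q) →ₗ[ZMod q] ZMod q) := by
      rw [Submodule.span_le]
      rintro _ ⟨c, rfl⟩
      exact he c
    exact fun y hy => this hy
  apply le_antisymm
  · rw [Submodule.span_le]
    rintro x (rfl | ⟨c, rfl⟩)
    · refine (hmem _).2 ⟨nsmul_mem hv _, ?_⟩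
      rw [Pi.smul_apply, addOrderOf_nsmul_eq_zero]
    · exact (hmem _).2 ⟨hh c, he c⟩
  · intro x hx
    obtain ⟨hx, hxe⟩ := (hmem x).1 hx
    rw [← hspan, Submodule.mem_span_insert] at hx
    obtain ⟨a, y, hy, rfl⟩ := hx
    rw [Pi.add_apply, hzero y hy, add_zero, Pi.smul_apply, smul_eq_mul] at hxe
    have h1 : a.val • v e = 0 := by simpa using hxe
    obtain ⟨b, hb⟩ := addOrderOf_dvd_of_nsmul_eq_zero h1
    refine Submodule.mem_span_insert.2 ⟨b, y, hy, ?_⟩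
    congr 1
    have h2 : a • v = a.val • v := by
      ext i; simp
    rw [h2, hb, mul_comm, mul_smul, Nat.cast_smul_eq_nsmul]

end ColumnOperations

/-! ### The program -/

/-- The matrix entry in row `r` and column `c` of the working copy. -/
def Expr.entry (r c : Expr) : Expr := .read 3 (.op .add (.op .mul r (.var 1)) c)

/-- One step of the Euclidean algorithm, applied to the pivot column and column `c`, for the
entries in row `e`; `e` and `c` are the variables `8` and `9`. -/
def euclidStep : Program :=
  .seq (.assign 0 (.const 10) (.op .div (.read 4 (.var 8)) (.entry (.var 8) (.var 9))))
    (.countdown 11 (.var 0)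
      (.seq (.assign 0 (.const 12) (.op .mod (.op .add (.read 4 (.var 11))
          (.op .mul (.op .sub (.var 2) (.var 10)) (.entry (.var 11) (.var 9)))) (.var 2)))
        (.seq (.assign 4 (.var 11) (.entry (.var 11) (.var 9)))
          (.assign 3 (.op .add (.op .mul (.var 11) (.var 1)) (.var 9)) (.var 12)))))

/-- The pivot column is `V` and the other columns form the matrix `H`. -/
def Holds (m k : ℕ) (V : ℕ → ℕ) (H : ℕ → ℕ → ℕ) (M : Memory) : Prop :=
  ∀ r < m, M 4 r = V r ∧ ∀ c < k, M 3 (r * k + c) = H r c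

theorem index_injective {k r r' c c' : ℕ} (hc : c < k) (hc' : c' < k)
    (h : r * k + c = r' * k + c') : r = r' ∧ c = c' := by
  have h1 : (r * k + c) % k = c := by rw [Nat.mul_add_mod', Nat.mod_eq_of_lt hc]
  have h2 : (r' * k + c') % k = c' := by rw [Nat.mul_add_mod', Nat.mod_eq_of_lt hc']
  have h3 : c = c' := by rw [← h1, ← h2, h]
  subst h3
  exact ⟨Nat.eq_of_mul_eq_mul_right (by omega) (by omega : r * k = r' * k), rfl⟩

theorem index_lt {m k r c : ℕ} (hr : r < m) (hc : c < k) : r * k + c < m * k := by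
  nlinarith

/-- `X` is large enough for all numbers that occur in the matrix computations. -/
structure LargeFor (m k q X : ℕ) : Prop where
  hundred_le : 100 ≤ X
  size_le : m * k ≤ X
  square_le : q + q * q ≤ X

/-- The first three scalar variables. -/
structure Dims (m k q : ℕ) (M : Memory) : Prop where
  rows : M 0 0 = m
  cols : M 0 1 = k
  modulus : M 0 2 = q

theorem Dims.of_agree {m k q lo : ℕ} {bs : List ℕ} {M M' : Memory} (h : Dims m k q M)
    (hA : Agree lo bs M M') (hlo : 3 ≤ lo) : Dims m k q M' :=
  ⟨(hA.1 0 (by omega)).trans h.rows, (hA.1 1 (by omega)).trans h.cols,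
    (hA.1 2 (by omega)).trans h.modulus⟩

/-- Cells hold natural numbers, so -t is represented by q - t. In the loop invariant, rows from i on
are already transformed. -/
theorem euclidStep_spec {X m k q : ℕ} (hX : LargeFor m k q X) {V : ℕ → ℕ} {H : ℕ → ℕ → ℕ}
    (hV : ∀ r < m, V r < q) (hH : ∀ r < m, ∀ c < k, H r c < q) {M : Memory} (hM : Dims m k q M)
    {e c : ℕ} (he : M 0 8 = e) (hc : M 0 9 = c) (hem : e < m) (hck : c < k)
    (hold : Holds m k V H M) :
    ∃ M', euclidStep.Steps X M M' (5 * m + 3) ∧ Agree 10 [3, 4] M M' ∧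
      Holds m k (fun r => H r c) (fun r c' => if c' = c then
        (V r + (q - V e / H e c) * H r c) % q else H r c') M' := by
  have hidx : ∀ r < m, r * k + c ≤ X := fun r hr => (index_lt hr hck).le.trans hX.size_le
  have hmulk : ∀ r < m, r * k ≤ X := fun r hr => (Nat.le_add_right _ _).trans (hidx r hr)
  have hX100 := hX.hundred_le
  set t := V e / H e c with ht
  have h1 : (Program.assign 0 (.const 10)
      (.op .div (.read 4 (.var 8)) (.entry (.var 8) (.var 9)))).Steps X M (M.write 0 10 t) 1 := by
    have h := Program.Steps.assign (X := X) (b := 0) (M := M) (i := .const 10)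
      (e := .op .div (.read 4 (.var 8)) (.entry (.var 8) (.var 9)))
      (by simp only [Expr.Fits]; omega)
      (by
        simp only [Expr.Fits, Expr.entry, Expr.eval, ArithOp.apply, he, hc, hM.cols]
        exact ⟨by omega, ⟨by omega, by omega, hmulk e hem⟩, by omega, hidx e hem⟩)
      (by simp [Expr.nodes, Expr.entry])
    simpa [Expr.eval, Expr.entry, ArithOp.apply, he, hc, hM.cols, (hold e hem).1,
      (hold e hem).2 c hck] using h
  set M0 := M.write 0 10 t with hM0
  have hA0 : Agree 10 [3, 4] M M0 := (Agree.refl _ _ _).write_scalar le_rfl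
  have hold0 : Holds m k V H M0 := fun r hr => by simpa [hM0] using hold r hr
  have hdim0 := hM.of_agree hA0 (by omega)
  have h10 : M0 0 10 = t := by simp [hM0]
  have h9 : M0 0 9 = c := by simp [hM0, hc]
  obtain ⟨M', h2, hA', hold'⟩ := Program.Steps.countdown (X := X) (x := 11) (s := 3) (N := .var 0)
    (c := .seq (.assign 0 (.const 12) (.op .mod (.op .add (.read 4 (.var 11))
          (.op .mul (.op .sub (.var 2) (.var 10)) (.entry (.var 11) (.var 9)))) (.var 2)))
        (.seq (.assign 4 (.var 11) (.entry (.var 11) (.var 9)))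
          (.assign 3 (.op .add (.op .mul (.var 11) (.var 1)) (.var 9)) (.var 12))))
    (fun i M' => Agree 11 [3, 4] M0 M' ∧ Holds m k (fun r => if i ≤ r then H r c else V r)
      (fun r c' => if c' = c ∧ i ≤ r then (V r + (q - t) * H r c) % q else H r c') M')
    (by omega) (by omega) (M := M0) (by simp only [Expr.Fits]; omega) (by simp [Expr.nodes])
    (fun i M' v h => ⟨h.1.write_scalar le_rfl, fun r hr => by simpa using h.2 r hr⟩)
    (fun i hi M' hxi h => by
      obtain ⟨hA, hold'⟩ := h
      have him : i < m := by simpa [Expr.eval, hdim0.rows] using hi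
      have hdim := hdim0.of_agree hA (by omega)
      have e10 : M' 0 10 = t := (hA.1 10 (by omega)).trans h10
      have e9 : M' 0 9 = c := (hA.1 9 (by omega)).trans h9
      have eV : M' 4 i = V i := by simpa using (hold' i him).1
      have eH : M' 3 (i * k + c) = H i c := by simpa using (hold' i him).2 c hck
      have hVi := hV i him
      have hHi := hH i him c hck
      have hmul : (q - t) * H i c ≤ q * q := Nat.mul_le_mul (Nat.sub_le _ _) hHi.le
      have hsq := hX.square_le
      set w := (V i + (q - t) * H i c) % q with hw
      have s1 := Program.Steps.assign (X := X) (b := 0) (M := M') (i := .const 12)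
        (e := .op .mod (.op .add (.read 4 (.var 11))
          (.op .mul (.op .sub (.var 2) (.var 10)) (.entry (.var 11) (.var 9)))) (.var 2))
        (by simp only [Expr.Fits]; omega)
        (by
          simp only [Expr.Fits, Expr.entry, Expr.eval, ArithOp.apply, hxi, e9, e10, hdim.cols,
            hdim.modulus, eV, eH]
          exact ⟨⟨by omega, ⟨⟨by omega, by omega⟩, ⟨⟨by omega, by omega, hmulk i him⟩, by omega,
            hidx i him⟩, by omega⟩, by omega⟩, by omega⟩)
        (by simp [Expr.nodes, Expr.entry])
      simp only [Expr.entry, Expr.eval, ArithOp.apply, hxi, e9, e10, hdim.cols,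
            hdim.modulus, eV, eH] at s1
      have s2 := Program.Steps.assign (X := X) (b := 4) (M := M'.write 0 12 w) (i := .var 11)
        (e := .entry (.var 11) (.var 9))
        (by simp only [Expr.Fits]; omega)
        (by
          simp [Expr.Fits, Expr.entry, Expr.eval, ArithOp.apply, hxi, e9, hdim.cols]
          exact ⟨⟨by omega, by omega, hmulk i him⟩, by omega, hidx i him⟩)
        (by simp [Expr.nodes, Expr.entry])
      simp [Expr.entry, Expr.eval, ArithOp.apply, hxi, e9, hdim.cols, eH] at s2
      have s3 := Program.Steps.assign (X := X) (b := 3) (M := (M'.write 0 12 w).write 4 i (H i c))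
        (i := .op .add (.op .mul (.var 11) (.var 1)) (.var 9)) (e := .var 12)
        (by
          simp [Expr.Fits, Expr.eval, ArithOp.apply, hxi, e9, hdim.cols]
          exact ⟨⟨by omega, by omega, hmulk i him⟩, by omega, hidx i him⟩)
        (by simp only [Expr.Fits]; omega)
        (by simp [Expr.nodes])
      simp [Expr.eval, ArithOp.apply, hxi, e9, hdim.cols] at s3
      refine ⟨_, (s1.seq (s2.seq s3)), by simp [hxi], ?_, ?_⟩
      · exact ((hA.write_scalar (by omega)).write_bank (by simp) (by omega)).write_bank (by simp)
          (by omega)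
      · intro r hr
        constructor
        · have := (hold' r hr).1
          by_cases hri : r = i
          · simp [hri]
          · simp only [Memory.write_apply, hri, and_false, if_false]
            simp only [show ¬((4 : ℕ) = 3) by omega, show ¬((4 : ℕ) = 0) by omega, false_and, if_false]
            rw [this]
            refine if_congr ⟨?_, ?_⟩ rfl rfl <;> omega
        · intro c' hc'
          have := (hold' r hr).2 c' hc'
          by_cases hri : r = i ∧ c' = c
          · simp [hri.1, hri.2, hw]
          · have hne : r * k + c' ≠ i * k + c := fun h => hri (index_injective hc' hck h)
            simp only [Memory.write_apply, hne, and_false, if_false]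
            simp only [show ¬((3 : ℕ) = 4) by omega, show ¬((3 : ℕ) = 0) by omega, false_and, if_false]
            rw [this]
            refine if_congr ⟨?_, ?_⟩ rfl rfl <;> omega)
    ⟨Agree.refl _ _ _, fun r hr => by
      have hNm : (Expr.var 0).eval M0 = m := by simp [Expr.eval, hdim0.rows]
      simpa [hNm, hr.not_ge] using hold0 r hr⟩
  refine ⟨M', (h1.seq h2).mono ?_, hA0.trans (hA'.mono (by omega) (by simp)), ?_⟩
  · have hNm : (Expr.var 0).eval M0 = m := by simp [Expr.eval, hdim0.rows]
    rw [hNm]; omega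
  · intro r hr
    simpa using hold' r hr

/-- Decreases in every step of the Euclidean algorithm. -/
def euclidMeasure (a b : ℕ) : ℕ := Nat.size a + Nat.size b + if a < b then 1 else 0

/-- If b ≤ a, then a % b is at most a/2 and loses a binary digit. If a < b, the step only swaps the
two numbers, and the extra 1 in the measure pays for it. -/
theorem euclidMeasure_mod_lt {a b : ℕ} (hb : b ≠ 0) :
    euclidMeasure b (a % b) < euclidMeasure a b := by
  unfold euclidMeasure
  have hmod := Nat.mod_lt a (Nat.pos_of_ne_zero hb)
  rw [if_neg hmod.not_gt]
  split_ifs with hab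
  · rw [Nat.mod_eq_of_lt hab]; omega
  · suffices Nat.size (a % b) < Nat.size a by omega
    have h1 : 2 * (a % b) ≤ a := by
      have := Nat.div_add_mod a b
      have h2 : 1 ≤ a / b := Nat.div_pos (by omega) (Nat.pos_of_ne_zero hb)
      have : b * 1 ≤ b * (a / b) := Nat.mul_le_mul_left _ h2
      omega
    rw [Nat.lt_size]
    rcases Nat.eq_zero_or_pos (a % b) with h0 | h0
    · rw [h0, Nat.size_zero, pow_zero]; omega
    · have h3 : 0 < Nat.size (a % b) := Nat.size_pos.2 h0
      have h4 := Nat.lt_size.1 (Nat.sub_lt h3 one_pos)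
      rw [← Nat.sub_add_cancel (show 1 ≤ Nat.size (a % b) from h3), pow_succ]
      omega

theorem euclidMeasure_le {a b q : ℕ} (ha : a ≤ q) (hb : b ≤ q) :
    euclidMeasure a b ≤ 2 * Nat.size q + 1 := by
  unfold euclidMeasure
  have := Nat.size_le_size ha
  have := Nat.size_le_size hb
  split_ifs <;> omega

/-- The columns of `H` as vectors modulo `q`. -/
def columns (q m k : ℕ) (H : ℕ → ℕ → ℕ) (c : Fin k) (r : Fin m) : ZMod q := (H r c : ZMod q)

/-- `V` and `H` have entries below `q`, and `V` together with the columns of `H` generates `W`. -/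
structure Generates (q m k : ℕ) (V : ℕ → ℕ) (H : ℕ → ℕ → ℕ)
    (W : Submodule (ZMod q) (Fin m → ZMod q)) : Prop where
  pivot_lt : ∀ r < m, V r < q
  entry_lt : ∀ r < m, ∀ c < k, H r c < q
  span_eq : Submodule.span (ZMod q)
    (insert (fun r : Fin m => (V r : ZMod q)) (Set.range (columns q m k H))) = W

theorem Generates.euclid {q m k : ℕ} [NeZero q] {V : ℕ → ℕ} {H : ℕ → ℕ → ℕ}
    {W : Submodule (ZMod q) (Fin m → ZMod q)} (h : Generates q m k V H W) {c : ℕ} (hc : c < k)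
    (t : ℕ) : Generates q m k (fun r => H r c)
      (fun r c' => if c' = c then (V r + t * H r c) % q else H r c') W where
  pivot_lt r hr := h.entry_lt r hr c hc
  entry_lt r hr c' hc' := by
    split_ifs
    · exact Nat.mod_lt _ (NeZero.pos q)
    · exact h.entry_lt r hr c' hc'
  span_eq := by
    rw [← h.span_eq]
    refine Eq.trans ?_ (span_insert_range_euclid (fun r : Fin m => (V r : ZMod q))
      (columns q m k H) ⟨c, hc⟩ (t : ZMod q))
    congr 3
    funext c'
    by_cases hcc : c' = ⟨c, hc⟩
    · subst hcc
      ext r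
      simp [columns]
    · have : (c' : ℕ) ≠ c := fun h => hcc (Fin.ext h)
      ext r
      simp [columns, hcc, this]

/-- Column operations that make the entry in row `e` and column `c` zero. -/
def eliminateColumn : Program := .loop (.entry (.var 8) (.var 9)) euclidStep

theorem eliminateColumn_spec {X m k q : ℕ} [NeZero q] (hX : LargeFor m k q X)
    {W : Submodule (ZMod q) (Fin m → ZMod q)} {V : ℕ → ℕ} {H : ℕ → ℕ → ℕ}
    (hgen : Generates q m k V H W) {M : Memory} (hM : Dims m k q M)
    {e c : ℕ} (he : M 0 8 = e) (hc : M 0 9 = c) (hem : e < m) (hck : c < k)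
    (hold : Holds m k V H M) :
    ∃ M' V' H', eliminateColumn.Steps X M M' ((2 * Nat.size q + 1) * (5 * m + 4) + 1) ∧
      Agree 10 [3, 4] M M' ∧ Holds m k V' H' M' ∧ Generates q m k V' H' W ∧ H' e c = 0 ∧
      ∀ r c', c' ≠ c → H' r c' = H r c' := by
  have hidx : e * k + c ≤ X := (index_lt hem hck).le.trans hX.size_le
  have hX100 := hX.hundred_le
  obtain ⟨M', h1, h2, n', hA, V', H', hold', hgen', hcol, -⟩ :=
    Program.Steps.loop_of_invariant (X := X) (s := 5 * m + 3)
    (e := .entry (.var 8) (.var 9)) (c := euclidStep)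
    (fun n M' => Agree 10 [3, 4] M M' ∧ ∃ V' H', Holds m k V' H' M' ∧ Generates q m k V' H' W ∧
      (∀ r c', c' ≠ c → H' r c' = H r c') ∧ euclidMeasure (V' e) (H' e c) = n)
    (by simp [Expr.nodes, Expr.entry])
    (fun n M' h => by
      have e8 : M' 0 8 = e := (h.1.1 8 (by omega)).trans he
      have e9 : M' 0 9 = c := (h.1.1 9 (by omega)).trans hc
      have hdim := hM.of_agree h.1 (by omega)
      simp only [Expr.Fits, Expr.entry, Expr.eval, ArithOp.apply, e8, e9, hdim.cols]
      exact ⟨⟨by omega, by omega, by omega⟩, by omega, hidx⟩)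
    (fun n M' h h0 => by
      obtain ⟨hA, V', H', hold', hgen', hcol, hn⟩ := h
      have e8 : M' 0 8 = e := (hA.1 8 (by omega)).trans he
      have e9 : M' 0 9 = c := (hA.1 9 (by omega)).trans hc
      have hdim := hM.of_agree hA (by omega)
      have hne : H' e c ≠ 0 := by
        simpa [Expr.entry, Expr.eval, ArithOp.apply, e8, e9, hdim.cols, (hold' e hem).2 c hck]
          using h0
      obtain ⟨M'', hs, hA', hold''⟩ := euclidStep_spec hX hgen'.pivot_lt hgen'.entry_lt hdim e8 e9
        hem hck hold'
      refine ⟨_, ?_, M'', hs, hA.trans hA', _, _, hold'', hgen'.euclid hck _, ?_, rfl⟩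
      -- In row e the operation modulo q is an exact integer division step, since the remainder is
      -- below q.
      · have hmod : (V' e + (q - V' e / H' e c) * H' e c) % q = V' e % H' e c := by
          have h1 := Nat.div_add_mod (V' e) (H' e c)
          have hVe := hgen'.pivot_lt e hem
          have h2 : V' e / H' e c ≤ q := (Nat.div_le_self _ _).trans hVe.le
          have h3 : V' e + (q - V' e / H' e c) * H' e c = V' e % H' e c + H' e c * q := by
            obtain ⟨s, hs⟩ := Nat.exists_eq_add_of_le h2
            rw [hs, Nat.add_sub_cancel_left]
            rw [← hs, mul_comm _ q]
            nlinarith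
          rw [h3, Nat.add_mul_mod_self_right]
          exact Nat.mod_eq_of_lt ((Nat.mod_le _ _).trans_lt hVe)
        rw [if_pos rfl, hmod, ← hn]
        exact euclidMeasure_mod_lt hne
      · intro r c' hc'
        rw [if_neg hc', hcol r c' hc'])
    (M := M) ⟨Agree.refl _ _ _, V, H, hold, hgen, fun _ _ _ => rfl, rfl⟩
  have hdim := hM.of_agree hA (by omega)
  have e8 : M' 0 8 = e := (hA.1 8 (by omega)).trans he
  have e9 : M' 0 9 = c := (hA.1 9 (by omega)).trans hc
  refine ⟨M', V', H', h1.mono ?_, hA, hold', hgen', ?_, hcol⟩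
  · have := euclidMeasure_le (hgen.pivot_lt e hem).le (hgen.entry_lt e hem c hck).le
    have := Nat.mul_le_mul_right (1 + (5 * m + 3)) this
    linarith
  · simpa [Expr.entry, Expr.eval, ArithOp.apply, e8, e9, hdim.cols, (hold' e hem).2 c hck] using h2

/-- The greatest common divisor of the variables `10` and `11`, computed in variable `11`. -/
def gcdLoop : Program :=
  .loop (.var 10) (.seq (.assign 0 (.const 12) (.op .mod (.var 11) (.var 10)))
    (.seq (.assign 0 (.const 11) (.var 10)) (.assign 0 (.const 10) (.var 12))))

theorem gcdLoop_spec {X x y q : ℕ} (hX : 100 ≤ X) {M : Memory} (hx : M 0 10 = x) (hy : M 0 11 = y)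
    (hxq : x ≤ q) (hyq : y ≤ q) :
    ∃ M', gcdLoop.Steps X M M' ((2 * Nat.size q + 1) * 4 + 1) ∧ Agree 10 [] M M' ∧
      M' 0 11 = Nat.gcd y x := by
  obtain ⟨M', h1, h2, n', hA, hg, -⟩ := Program.Steps.loop_of_invariant (X := X) (s := 3)
    (e := .var 10) (c := .seq (.assign 0 (.const 12) (.op .mod (.var 11) (.var 10)))
      (.seq (.assign 0 (.const 11) (.var 10)) (.assign 0 (.const 10) (.var 12))))
    (fun n M' => Agree 10 [] M M' ∧ Nat.gcd (M' 0 11) (M' 0 10) = Nat.gcd y x ∧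
      euclidMeasure (M' 0 11) (M' 0 10) = n)
    (by simp [Expr.nodes]) (fun _ _ _ => by simp only [Expr.Fits]; omega)
    (fun n M' h h0 => by
      obtain ⟨hA, hg, hn⟩ := h
      have h0 : M' 0 10 ≠ 0 := by simpa [Expr.eval] using h0
      have s1 := Program.Steps.assign (X := X) (b := 0) (M := M') (i := .const 12)
        (e := .op .mod (.var 11) (.var 10)) (by simp only [Expr.Fits]; omega)
        (by simp only [Expr.Fits]; omega) (by simp [Expr.nodes])
      have s2 := Program.Steps.assign (X := X) (b := 0) (M := M'.write 0 12 (M' 0 11 % M' 0 10))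
        (i := .const 11) (e := .var 10) (by simp only [Expr.Fits]; omega)
        (by simp only [Expr.Fits]; omega) (by simp [Expr.nodes])
      have s3 := Program.Steps.assign (X := X) (b := 0)
        (M := (M'.write 0 12 (M' 0 11 % M' 0 10)).write 0 11 (M' 0 10))
        (i := .const 10) (e := .var 12) (by simp only [Expr.Fits]; omega)
        (by simp only [Expr.Fits]; omega) (by simp [Expr.nodes])
      simp only [Expr.eval, ArithOp.apply] at s1
      simp [Expr.eval] at s2 s3
      refine ⟨_, ?_, _, s1.seq (s2.seq s3),
        ((hA.write_scalar (by omega)).write_scalar (by omega)).write_scalar le_rfl, ?_, rfl⟩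
      · simp only [Memory.write_apply]
        simp only [Nat.reduceEqDiff, and_false, and_self, if_true, if_false]
        rw [← hn]
        exact euclidMeasure_mod_lt h0
      · simp only [Memory.write_apply]
        simp only [Nat.reduceEqDiff, and_false, and_self, if_true, if_false]
        rw [← hg, Nat.gcd_comm, ← Nat.gcd_rec, Nat.gcd_comm])
    (M := M) ⟨Agree.refl _ _ _, by rw [hx, hy], rfl⟩
  refine ⟨M', h1.mono ?_, hA, ?_⟩
  · have := Nat.mul_le_mul_right (1 + 3) (euclidMeasure_le (hy ▸ hyq) (hx ▸ hxq))
    linarith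
  · rw [← hg, show M' 0 10 = 0 by simpa [Expr.eval] using h2, Nat.gcd_zero_right]

/-- `for x = N - 1, ..., 0` write the value of `ex` into cell `x` of bank `b`. -/
def fillBank (x b : ℕ) (N ex : Expr) : Program := .countdown x N (.assign b (.var x) ex)

theorem fillBank_spec {X x b : ℕ} {N ex : Expr} (f : ℕ → ℕ) (hx : x ≤ X) (hX : 1 ≤ X) (hb : b ≠ 0)
    {M : Memory} (hN : N.Fits X M) (hnN : N.nodes < 39) (hnex : ex.nodes < 38)
    (h : ∀ i < N.eval M, ∀ M', M' 0 x = i → Agree x [b] M M' → M' b i = M b i →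
      ex.Fits X M' ∧ ex.eval M' = f i) :
    ∃ M', (fillBank x b N ex).Steps X M M' (N.eval M * 3 + 2) ∧ Agree x [b] M M' ∧
      ∀ i < N.eval M, M' b i = f i := by
  obtain ⟨M', h1, h2, -, h3⟩ := Program.Steps.countdown (X := X) (x := x) (s := 1) (N := N)
    (c := .assign b (.var x) ex)
    (fun i M' => Agree x [b] M M' ∧ (∀ j < i, M' b j = M b j) ∧
      ∀ j, i ≤ j → j < N.eval M → M' b j = f j)
    hx hX (M := M) hN hnN
    (fun i M' v h => ⟨h.1.write_scalar le_rfl, fun j hj => by simpa [hb] using h.2.1 j hj,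
      fun j hj hj' => by simpa [hb] using h.2.2 j hj hj'⟩)
    (fun i hi M' hxi hI => by
      obtain ⟨hA, hlo, hhi⟩ := hI
      obtain ⟨hfit, hval⟩ := h i hi M' hxi hA (hlo i (by omega))
      have s := Program.Steps.assign (X := X) (b := b) (M := M') (i := .var x) (e := ex)
        hx hfit (by simp only [Expr.nodes]; omega)
      have ex : (Expr.var x).eval M' = i := by simpa [Expr.eval] using hxi
      rw [ex, hval] at s
      refine ⟨_, s, by simpa [hb.symm] using hxi, hA.write_bank (by simp) hb, fun j hj => ?_,
        fun j hj hj' => ?_⟩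
      · rw [Memory.write_apply, if_neg (by omega)]
        exact hlo j (by omega)
      · rw [Memory.write_apply]
        split_ifs with hji
        · rw [hji.2]
        · exact hhi j (by omega) hj')
    ⟨Agree.refl _ _ _, fun _ _ => rfl, fun j hj hj' => by omega⟩
  exact ⟨M', h1, h2, fun i hi => h3 i (Nat.zero_le _) hi⟩

/-- Restricts the code generated by the working copy to the codewords that vanish at row `e`, and
computes the number of values of codewords at `e` in variable `9`; `e` is the variable `8`. -/
def contractRow : Program :=
  .seq (.countdown 9 (.var 1) eliminateColumn)
    (.seq (.assign 0 (.const 10) (.read 4 (.var 8)))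
      (.seq (.assign 0 (.const 11) (.var 2))
        (.seq gcdLoop
          (.seq (.assign 0 (.const 9) (.op .div (.var 2) (.var 11)))
            (fillBank 11 4 (.var 0) (.op .mod (.op .mul (.read 4 (.var 11)) (.var 9)) (.var 2)))))))

def contractSteps (m k s : ℕ) : ℕ :=
  k * (2 + ((2 * s + 1) * (5 * m + 4) + 1)) + 2 + (1 + (1 + ((2 * s + 1) * 4 + 1 + (1 + (m * 3 + 2)))))

/-- Clearing one column leaves the other non-pivot columns alone, so zeros already made in row e
persist. Once only the pivot is nonzero there, its order q / gcd(q, V e) is the jump, and scaling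
the pivot by it imposes the zero at e. -/
theorem contractRow_spec {X m k q : ℕ} [NeZero q] (hX : LargeFor m k q X)
    {C : Submodule (ZMod q) (Fin m → ZMod q)} {A : Finset (Fin m)} {V : ℕ → ℕ} {H : ℕ → ℕ → ℕ}
    (hgen : Generates q m k V H (vanishingOn C A)) {M : Memory} (hM : Dims m k q M)
    {e : Fin m} (he : M 0 8 = e) (hold : Holds m k V H M) :
    ∃ M' V' H', contractRow.Steps X M M' (contractSteps m k (Nat.size q)) ∧ Agree 9 [3, 4] M M' ∧
      M' 0 9 = jump C A e ∧ Holds m k V' H' M' ∧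
      Generates q m k V' H' (vanishingOn C (insert e A)) := by
  have hX100 := hX.hundred_le
  have hsq := hX.square_le
  obtain ⟨M1, s1, hA1, V1, H1, hold1, hgen1, hz1⟩ := Program.Steps.countdown (X := X) (x := 9)
    (s := (2 * Nat.size q + 1) * (5 * m + 4) + 1) (N := .var 1) (c := eliminateColumn)
    (fun i M' => Agree 9 [3, 4] M M' ∧ ∃ V' H', Holds m k V' H' M' ∧
      Generates q m k V' H' (vanishingOn C A) ∧ ∀ c, i ≤ c → c < k → H' e c = 0)
    (by omega) (by omega) (M := M) (by simp only [Expr.Fits]; omega) (by simp [Expr.nodes])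
    (fun i M' v h => by
      obtain ⟨hA, V', H', hold', hrest⟩ := h
      exact ⟨hA.write_scalar le_rfl, V', H', fun r hr => by simpa using hold' r hr, hrest⟩)
    (fun i hi M' hxi h => by
      obtain ⟨hA, V', H', hold', hgen', hz⟩ := h
      have hik : i < k := by simpa [Expr.eval, hM.cols] using hi
      obtain ⟨M'', V'', H'', hs, hA', hold'', hgen'', hz0, hcol⟩ := eliminateColumn_spec hX hgen'
        (hM.of_agree hA (by omega)) ((hA.1 8 (by omega)).trans he) hxi e.2 hik hold'
      refine ⟨M'', hs, (hA'.1 9 (by omega)).trans hxi, hA.trans (hA'.mono (by omega) (by simp)),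
        V'', H'', hold'', hgen'', fun c hc hck => ?_⟩
      by_cases hci : c = i
      · rw [hci, hz0]
      · rw [hcol _ _ hci]
        exact hz c (by omega) hck)
    ⟨Agree.refl _ _ _, V, H, hold, hgen, fun c hc hck => by
      simp only [Expr.eval, hM.cols] at hc; omega⟩
  have hd1 := hM.of_agree hA1 (by omega)
  have e1 : M1 0 8 = e := (hA1.1 8 (by omega)).trans he
  have hN1 : (Expr.var 1).eval M = k := by simp [Expr.eval, hM.cols]
  rw [hN1] at s1
  have s2 := Program.Steps.assign (X := X) (b := 0) (M := M1) (i := .const 10)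
    (e := .read 4 (.var 8)) (by simp only [Expr.Fits]; omega) (by simp only [Expr.Fits]; omega)
    (by simp [Expr.nodes])
  simp only [Expr.eval, e1, (hold1 e e.2).1] at s2
  set M2 := M1.write 0 10 (V1 e) with hM2
  have s3 := Program.Steps.assign (X := X) (b := 0) (M := M2) (i := .const 11)
    (e := .var 2) (by simp only [Expr.Fits]; omega) (by simp only [Expr.Fits]; omega)
    (by simp [Expr.nodes])
  have e23 : (Expr.var 2).eval M2 = q := by simp [Expr.eval, hM2, hd1.modulus]
  rw [e23] at s3
  set M3 := M2.write 0 11 q with hM3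
  obtain ⟨M4, s4, hA4, hg4⟩ := gcdLoop_spec (M := M3) (x := V1 e) (y := q) (q := q) hX100
    (by simp [hM3, hM2]) (by simp [hM3]) (hgen1.pivot_lt e e.2).le le_rfl
  have hA3 : Agree 9 [3, 4] M1 M3 :=
    ((Agree.refl _ _ _).write_scalar (by omega)).write_scalar (by omega)
  have hA34 : Agree 9 [3, 4] M1 M4 := hA3.trans (hA4.mono (by omega) (by simp))
  have hd4 := hd1.of_agree hA34 (by omega)
  have hz : ∀ c, columns q m k H1 c e = 0 := fun c => by
    simp [columns, hz1 c (Nat.zero_le _) c.2]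
  have hj : q / Nat.gcd q (V1 e) = jump C A e := by
    rw [jump_eq_addOrderOf hgen1.span_eq hz, ZMod.addOrderOf_coe _ (NeZero.ne q)]
  have s5 := Program.Steps.assign (X := X) (b := 0) (M := M4) (i := .const 9)
    (e := .op .div (.var 2) (.var 11)) (by simp only [Expr.Fits]; omega)
    (by simp only [Expr.Fits]; omega) (by simp [Expr.nodes])
  simp only [Expr.eval, ArithOp.apply, hd4.modulus, hg4, hj] at s5
  set j := jump C A e with hjdef
  set M5 := M4.write 0 9 j with hM5
  have hjq : j ≤ q := Nat.le_of_dvd (NeZero.pos q) (jump_dvd A e)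
  have hA5 : Agree 9 [3, 4] M1 M5 := hA34.write_scalar le_rfl
  have hd5 := hd1.of_agree hA5 (by omega)
  have hold5 : Holds m k V1 H1 M5 := fun r hr => by
    have h4 : ∀ b ∈ [3, 4], ∀ i, M5 b i = M1 b i := fun b hb i => by
      have hb0 : b ≠ 0 := by rintro rfl; simp at hb
      rw [hM5, Memory.write_apply, if_neg (by tauto), hA4.2 b hb0 (by simp)]
      simp [hM3, hM2, hb0]
    rw [h4 4 (by simp)]
    exact ⟨(hold1 r hr).1, fun c hc => by rw [h4 3 (by simp)]; exact (hold1 r hr).2 c hc⟩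
  have hN5 : (Expr.var 0).eval M5 = m := by simp [Expr.eval, hd5.rows]
  obtain ⟨M6, s6, hA6, hV6⟩ := fillBank_spec (X := X) (x := 11) (b := 4) (N := .var 0)
    (ex := .op .mod (.op .mul (.read 4 (.var 11)) (.var 9)) (.var 2))
    (fun r => V1 r * j % q) (by omega) (by omega) (by omega) (M := M5)
    (by simp only [Expr.Fits]; omega) (by simp [Expr.nodes]) (by simp [Expr.nodes])
    (fun i hi M' hxi hA hsame => by
      have him : i < m := by rwa [hN5] at hi
      have e4 : M' 4 i = V1 i := hsame.trans (hold5 i him).1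
      have e9 : M' 0 9 = j := (hA.1 9 (by omega)).trans (by simp [hM5])
      have e2 : M' 0 2 = q := (hd5.of_agree hA (by omega)).modulus
      have := Nat.mul_le_mul (hgen1.pivot_lt i him).le hjq
      simp only [Expr.Fits, Expr.eval, ArithOp.apply, hxi, e4, e9, e2]
      exact ⟨⟨⟨by omega, by omega, by omega⟩, by omega⟩, trivial⟩)
  rw [hN5] at s6 hV6
  refine ⟨M6, fun r => V1 r * j % q, H1, s1.seq (s2.seq (s3.seq (s4.seq (s5.seq s6)))),
    hA1.trans (hA5.trans (hA6.mono (by omega) (by simp))),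
    (hA6.1 9 (by omega)).trans (by simp [hM5]), fun r hr => ⟨hV6 r hr, fun c hc => ?_⟩, ?_⟩
  · rw [hA6.2 3 (by omega) (by simp)]
    exact (hold5 r hr).2 c hc
  · refine ⟨fun r _ => Nat.mod_lt _ (NeZero.pos q), hgen1.entry_lt, ?_⟩
    rw [← span_insert_addOrderOf_smul hgen1.span_eq hz, ← jump_eq_addOrderOf hgen1.span_eq hz]
    congr 2
    ext r
    simp [mul_comm, hjdef]

/-- One row of a round of the peeling process. -/
def processRow : Program :=
  .cond (.op .sub (.var 5) (.read 5 (.var 8)))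
    (.seq contractRow (.assign 5 (.var 8) (.op .mul (.read 5 (.var 8)) (.var 9)))) .skip

/-- One round of the peeling process. -/
def peelRoundProgram : Program :=
  .seq (fillBank 8 3 (.op .mul (.var 0) (.var 1)) (.read 1 (.var 8)))
    (.seq (fillBank 8 4 (.var 0) (.const 0)) (.countdown 8 (.var 0) processRow))

def roundSteps (m k s : ℕ) : ℕ :=
  m * k * 3 + 2 + (m * 3 + 2 + (m * (2 + (1 + (contractSteps m k s + 1))) + 2))

theorem generates_input {q m k : ℕ} [NeZero q] {C : Submodule (ZMod q) (Fin m → ZMod q)}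
    {G : Matrix (Fin m) (Fin k) (ZMod q)} (hG : LinearMap.range G.mulVecLin = C) {g : ℕ → ℕ}
    (hg : ∀ (r : Fin m) (c : Fin k), g (r * k + c) = (G r c).val) :
    Generates q m k (fun _ => 0) (fun r c => g (r * k + c)) (vanishingOn C ∅) where
  pivot_lt _ _ := NeZero.pos q
  entry_lt r hr c hc := by
    rw [hg ⟨r, hr⟩ ⟨c, hc⟩]
    exact ZMod.val_lt _
  span_eq := by
    have h1 : vanishingOn C ∅ = C := by ext c; simp [mem_vanishingOn]
    have h2 : columns q m k (fun r c => g (r * k + c)) = G.col := by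
      ext c r
      simp [columns, hg]
    rw [h1, h2, ← hG, Matrix.range_mulVecLin]
    simp only [Nat.cast_zero]
    exact Submodule.span_insert_zero

/-- Each accumulator changes only when its own row is visited, so the test made at that moment
agrees with activity at the start of the round. The working copy always generates the subcode
vanishing on the active rows visited so far. -/
theorem peelRoundProgram_spec {X m k q Q : ℕ} [NeZero q] (hX : LargeFor m k q X)
    (hQX : Q * q ≤ X) {C : Submodule (ZMod q) (Fin m → ZMod q)}
    {G : Matrix (Fin m) (Fin k) (ZMod q)} (hG : LinearMap.range G.mulVecLin = C)
    {M : Memory} (hM : Dims m k q M) (hMQ : M 0 5 = Q)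
    (hMG : ∀ (r : Fin m) (c : Fin k), M 1 (r * k + c) = (G r c).val) {acc : Fin m → ℕ}
    (hacc : ∀ e : Fin m, M 5 e = acc e) :
    ∃ M', peelRoundProgram.Steps X M M' (roundSteps m k (Nat.size q)) ∧ Agree 8 [3, 4, 5] M M' ∧
      ∀ e : Fin m, M' 5 e = peelRound C Q acc e := by
  have hX100 := hX.hundred_le
  have hN1 : (Expr.op .mul (.var 0) (.var 1)).eval M = m * k := by
    simp [Expr.eval, ArithOp.apply, hM.rows, hM.cols]
  obtain ⟨M1, s1, hA1, hH1⟩ := fillBank_spec (X := X) (x := 8) (b := 3)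
    (N := .op .mul (.var 0) (.var 1)) (ex := .read 1 (.var 8)) (M 1) (by omega) (by omega)
    (by omega) (M := M)
    (by
      simp only [Expr.Fits, Expr.eval, hM.rows, hM.cols]
      exact ⟨by omega, by omega, hX.size_le⟩)
    (by simp [Expr.nodes]) (by simp [Expr.nodes])
    (fun i hi M' hxi hA _ => ⟨by simp only [Expr.Fits]; omega, by
      simp only [Expr.eval, hxi]; exact hA.2 1 (by omega) (by simp) i⟩)
  rw [hN1] at s1 hH1
  have hd1 := hM.of_agree hA1 (by omega)
  have hN2 : (Expr.var 0).eval M1 = m := by simp [Expr.eval, hd1.rows]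
  obtain ⟨M2, s2, hA2, hV2⟩ := fillBank_spec (X := X) (x := 8) (b := 4)
    (N := .var 0) (ex := .const 0) (fun _ => 0) (by omega) (by omega)
    (by omega) (M := M1) (by simp only [Expr.Fits]; omega)
    (by simp [Expr.nodes]) (by simp [Expr.nodes])
    (fun i hi M' hxi hA _ => ⟨by simp only [Expr.Fits]; omega, rfl⟩)
  rw [hN2] at s2 hV2
  have hA12 : Agree 8 [3, 4, 5] M M2 := (hA1.mono le_rfl (by simp)).trans (hA2.mono le_rfl (by simp))
  have hd2 := hM.of_agree hA12 (by omega)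
  have hN3 : (Expr.var 0).eval M2 = m := by simp [Expr.eval, hd2.rows]
  have hold2 : Holds m k (fun _ => 0) (fun r c => M 1 (r * k + c)) M2 := fun r hr =>
    ⟨hV2 r hr, fun c hc => by
      rw [hA2.2 3 (by omega) (by simp)]
      exact hH1 _ (index_lt hr hc)⟩
  obtain ⟨M3, s3, hA3, V3, H3, -, -, hacc3⟩ := Program.Steps.countdown (X := X) (x := 8)
    (s := 1 + (contractSteps m k (Nat.size q) + 1)) (N := .var 0) (c := processRow)
    (fun i M' => Agree 8 [3, 4, 5] M M' ∧ ∃ V' H', Holds m k V' H' M' ∧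
      Generates q m k V' H' (vanishingOn C ((activeSet Q acc).filter fun e : Fin m => i ≤ (e : ℕ))) ∧
      ∀ e : Fin m, M' 5 e = if i ≤ (e : ℕ) then peelRound C Q acc e else acc e)
    (by omega) (by omega) (M := M2) (by simp only [Expr.Fits]; omega) (by simp [Expr.nodes])
    (fun i M' v h => by
      obtain ⟨hA, V', H', hold', hgen, hacc'⟩ := h
      exact ⟨hA.write_scalar le_rfl, V', H', fun r hr => by simpa using hold' r hr, hgen,
        fun e => by simpa using hacc' e⟩)
    (fun i hi M' hxi h => by
      obtain ⟨hA, V', H', hold', hgen, hacc'⟩ := h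
      have him : i < m := by rwa [hN3] at hi
      obtain ⟨e, rfl⟩ : ∃ e : Fin m, (e : ℕ) = i := ⟨⟨i, him⟩, rfl⟩
      have hd' := hM.of_agree hA (by omega)
      have e5 : M' 0 5 = Q := (hA.1 5 (by omega)).trans hMQ
      have eacc : M' 5 e = acc e := by simpa using hacc' e
      have hfilter : (activeSet Q acc).filter (fun e' : Fin m => (e : ℕ) + 1 ≤ (e' : ℕ)) =
          (activeSet Q acc).filter (e < ·) := by
        ext e'; simp
      rw [hfilter] at hgen
      have hguard : (Expr.op .sub (.var 5) (.read 5 (.var 8))).eval M' = Q - acc e := by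
        simp [Expr.eval, ArithOp.apply, hxi, e5, eacc]
      have hother : ∀ e' : Fin m, e' ≠ e → ((e : ℕ) ≤ (e' : ℕ) ↔ (e : ℕ) + 1 ≤ (e' : ℕ)) := fun e' hne => by
        have : (e' : ℕ) ≠ e := fun h => hne (Fin.ext h)
        omega
      by_cases hact : acc e < Q
      · obtain ⟨M'', V'', H'', hs, hA', hj, hold'', hgen''⟩ := contractRow_spec hX hgen hd'
          (e := e) hxi hold'
        have e8 : M'' 0 8 = e := (hA'.1 8 (by omega)).trans hxi
        have e5' : M'' 5 e = acc e := (hA'.2 5 (by omega) (by simp) e).trans eacc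
        set j := jump C ((activeSet Q acc).filter (e < ·)) e with hjdef
        have hjq : j ≤ q := Nat.le_of_dvd (NeZero.pos q) (jump_dvd _ _)
        have hmul : acc e * j ≤ X := (Nat.mul_le_mul hact.le hjq).trans hQX
        have sa := Program.Steps.assign (X := X) (b := 5) (M := M'') (i := .var 8)
          (e := .op .mul (.read 5 (.var 8)) (.var 9)) (by simp only [Expr.Fits]; omega)
          (by
            simp only [Expr.Fits, Expr.eval, e8, e5', hj]
            exact ⟨by omega, by omega, hmul⟩)
          (by simp [Expr.nodes])
        simp only [Expr.eval, ArithOp.apply, e8, e5', hj] at sa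
        refine ⟨_, Program.Steps.cond_true (by rw [hguard]; omega)
          (by simp only [Expr.Fits]; omega) (by simp [Expr.nodes]) (hs.seq sa), by simp [e8],
          (hA.trans (hA'.mono (by omega) (by simp))).write_bank (by simp) (by omega), V'', H'',
          fun r hr => by simpa using hold'' r hr, ?_, fun e' => ?_⟩
        · convert hgen'' using 2
          ext e'
          simp only [Finset.mem_filter, Finset.mem_insert, mem_activeSet]
          by_cases hne : e' = e
          · subst hne; simp [hact]
          · rw [hother e' hne]; simp [hne]
        · by_cases hne : e' = e
          · subst hne
            simp [peelRound, hact, hjdef]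
          · have hne' : (e' : ℕ) ≠ e := fun h => hne (Fin.ext h)
            rw [Memory.write_apply, if_neg (by tauto), hA'.2 5 (by omega) (by simp), hacc' e']
            exact if_congr (hother e' hne).symm rfl rfl
      · refine ⟨M', (Program.Steps.cond_false (by rw [hguard]; omega)
          (by simp only [Expr.Fits]; omega) (by simp [Expr.nodes]) (.skip _ _)).mono (by omega),
          hxi, hA, V', H', hold', ?_, fun e' => ?_⟩
        · convert hgen using 2
          ext e'
          simp only [Finset.mem_filter, mem_activeSet]
          by_cases hne : e' = e
          · subst hne; simp [hact]
          · rw [hother e' hne]; simp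
        · rw [hacc' e']
          by_cases hne : e' = e
          · subst hne
            simp [peelRound, hact]
          · exact if_congr (hother e' hne).symm rfl rfl)
    ⟨hA12, _, _, hold2, by
      have hempty : (activeSet Q acc).filter (fun e : Fin m => (Expr.var 0).eval M2 ≤ (e : ℕ)) = ∅ := by
        rw [hN3]
        exact Finset.filter_false_of_mem fun e _ => by omega
      rw [hempty]
      exact generates_input hG hMG, fun e => by
      rw [hN3, if_neg (by omega), hA2.2 5 (by omega) (by simp), hA1.2 5 (by omega) (by simp)]
      exact hacc e⟩
  rw [hN3] at s3
  exact ⟨M3, s1.seq (s2.seq s3), hA3, fun e => by simpa using hacc3 e⟩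

/-- The binary logarithm of variable `8`, rounded down, computed in variable `y`. -/
def logLoop (y : ℕ) : Program :=
  .seq (.assign 0 (.const y) (.const 0))
    (.loop (.op .div (.var 8) (.const 2))
      (.seq (.assign 0 (.const 8) (.op .div (.var 8) (.const 2)))
        (.assign 0 (.const y) (.op .add (.var y) (.const 1)))))

theorem logLoop_spec {X y x : ℕ} (hX : 100 ≤ X) (hy : y ≤ X) (hy8 : y ≠ 8) {M : Memory}
    (hx : M 0 8 = x) (hlog : Nat.log 2 x ≤ X) :
    ∃ M', (logLoop y).Steps X M M' (Nat.log 2 x * 3 + 2) ∧ M' 0 y = Nat.log 2 x ∧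
      ∀ b i, ¬(b = 0 ∧ (i = 8 ∨ i = y)) → M' b i = M b i := by
  have s1 := Program.Steps.assign (X := X) (b := 0) (M := M) (i := .const y) (e := .const 0)
    (by simp only [Expr.Fits]; omega) (by simp only [Expr.Fits]; omega) (by simp [Expr.nodes])
  simp only [Expr.eval] at s1
  obtain ⟨M', s2, h0, n, hsum, -, hframe⟩ := Program.Steps.loop_of_invariant (X := X) (s := 2)
    (e := .op .div (.var 8) (.const 2))
    (c := .seq (.assign 0 (.const 8) (.op .div (.var 8) (.const 2)))
        (.assign 0 (.const y) (.op .add (.var y) (.const 1))))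
    (fun n M' => M' 0 y + Nat.log 2 (M' 0 8) = Nat.log 2 x ∧ Nat.log 2 (M' 0 8) = n ∧
      ∀ b i, ¬(b = 0 ∧ (i = 8 ∨ i = y)) → M' b i = M b i)
    (by simp [Expr.nodes]) (fun _ _ _ => by simp only [Expr.Fits]; omega)
    (fun n M' h hne => by
      obtain ⟨hsum, hn, hframe⟩ := h
      simp only [Expr.eval, ArithOp.apply] at hne
      have h2 : 2 ≤ M' 0 8 := by omega
      have hlog2 := Nat.log_of_one_lt_of_le one_lt_two h2
      have sa := Program.Steps.assign (X := X) (b := 0) (M := M') (i := .const 8)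
        (e := .op .div (.var 8) (.const 2)) (by simp only [Expr.Fits]; omega)
        (by simp only [Expr.Fits]; omega) (by simp [Expr.nodes])
      have sb := Program.Steps.assign (X := X) (b := 0) (M := M'.write 0 8 (M' 0 8 / 2))
        (i := .const y) (e := .op .add (.var y) (.const 1)) hy
        (by simp [Expr.Fits, Expr.eval, hy8]; omega) (by simp [Expr.nodes])
      simp only [Expr.eval, ArithOp.apply] at sa
      simp [Expr.eval, ArithOp.apply, hy8] at sb
      refine ⟨n - 1, by omega, _, sa.seq sb, ?_, ?_, fun b i hbi => ?_⟩
      · simp [hy8.symm]; omega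
      · simp [hy8.symm]; omega
      · rw [Memory.write_apply, if_neg (by tauto), Memory.write_apply, if_neg (by tauto)]
        exact hframe b i hbi)
    (M := M.write 0 y 0) (n := Nat.log 2 x)
    ⟨by simp [hy8.symm, hx], by simp [hy8.symm, hx], fun b i hbi => by
      rw [Memory.write_apply, if_neg (by tauto)]⟩
  refine ⟨M', (s1.seq s2).mono (by omega), ?_, hframe⟩
  simp only [Expr.eval, ArithOp.apply] at h0
  rw [← hsum, Nat.log_of_lt (show M' 0 8 < 2 by omega), add_zero]

/-- Computes the threshold `q ^ 64` in variable `5` and the number of rounds in variable `6`. -/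
def setupProgram : Program :=
  .seq (.assign 0 (.const 5) (.var 2))
    (.seq (.countdown 8 (.const 6) (.assign 0 (.const 5) (.op .mul (.var 5) (.var 5))))
      (.seq (.assign 0 (.const 8) (.var 5))
        (.seq (logLoop 9)
          (.seq (.assign 0 (.const 8) (.const 1))
            (.seq (.countdown 10 (.op .mul (.var 9) (.var 4))
                (.assign 0 (.const 8) (.op .mul (.var 8) (.op .mul (.var 3) (.var 2)))))
              (logLoop 6))))))

def setupSteps (a d R : ℕ) : ℕ :=
  1 + (6 * (2 + 1) + 2 + (1 + (a * 3 + 2 + (1 + (a * d * (2 + 1) + 2 + (R * 3 + 2))))))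

theorem setupProgram_spec {X q n d : ℕ} (hX : 100 ≤ X) (hq : 2 ≤ q) (hn : 1 ≤ n)
    (hX1 : q ^ 64 ≤ X) (hX2 : Nat.log 2 (q ^ 64) * d ≤ X) (hX3 : n * q ≤ X)
    (hX4 : (n * q) ^ (Nat.log 2 (q ^ 64) * d) ≤ X)
    {M : Memory} (h2 : M 0 2 = q) (h3 : M 0 3 = n) (h4 : M 0 4 = d) :
    ∃ M', setupProgram.Steps X M M' (setupSteps (Nat.log 2 (q ^ 64)) d (roundCount q n d)) ∧
      Agree 5 [] M M' ∧ M' 0 5 = q ^ 64 ∧ M' 0 6 = roundCount q n d := by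
  set a := Nat.log 2 (q ^ 64) with ha
  have haX : a ≤ X := (Nat.log_le_self _ _).trans hX1
  have s1 := Program.Steps.assign (X := X) (b := 0) (M := M) (i := .const 5) (e := .var 2)
    (by simp only [Expr.Fits]; omega) (by simp only [Expr.Fits]; omega) (by simp [Expr.nodes])
  simp only [Expr.eval, h2] at s1
  set M1 := M.write 0 5 q with hM1
  have hA1 : Agree 5 [] M M1 := (Agree.refl _ _ _).write_scalar le_rfl
  obtain ⟨M2, s2, hA2, h52⟩ := Program.Steps.countdown (X := X) (x := 8) (s := 1) (N := .const 6)
    (c := .assign 0 (.const 5) (.op .mul (.var 5) (.var 5)))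
    -- Six squarings give q^64.
    (fun i M' => Agree 5 [] M M' ∧ M' 0 5 = q ^ 2 ^ (6 - i)) (by omega) (by omega) (M := M1)
    (by simp only [Expr.Fits]; omega) (by simp [Expr.nodes])
    (fun i M' v h => ⟨h.1.write_scalar (by omega), by simpa using h.2⟩)
    (fun i hi M' hxi h => by
      simp only [Expr.eval] at hi
      have hpow : q ^ 2 ^ (6 - (i + 1)) * q ^ 2 ^ (6 - (i + 1)) = q ^ 2 ^ (6 - i) := by
        rw [← pow_add, ← two_mul, ← pow_succ', show 6 - (i + 1) + 1 = 6 - i by omega]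
      have hle : q ^ 2 ^ (6 - i) ≤ X := by
        refine le_trans (Nat.pow_le_pow_right (by omega) ?_) hX1
        exact Nat.pow_le_pow_right two_pos (Nat.sub_le 6 i)
      have s := Program.Steps.assign (X := X) (b := 0) (M := M') (i := .const 5)
        (e := .op .mul (.var 5) (.var 5)) (by simp only [Expr.Fits]; omega)
        (by
          simp only [Expr.Fits, Expr.eval, h.2, hpow]
          exact ⟨by omega, by omega, hle⟩) (by simp [Expr.nodes])
      simp only [Expr.eval, ArithOp.apply, h.2, hpow] at s
      exact ⟨_, s, by simpa using hxi, h.1.write_scalar le_rfl, by simp⟩)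
    ⟨hA1, by simp [Expr.eval, hM1]⟩
  rw [show (2 : ℕ) ^ (6 - 0) = 64 by norm_num] at h52
  have s3 := Program.Steps.assign (X := X) (b := 0) (M := M2) (i := .const 8) (e := .var 5)
    (by simp only [Expr.Fits]; omega) (by simp only [Expr.Fits]; omega) (by simp [Expr.nodes])
  simp only [Expr.eval, h52] at s3
  obtain ⟨M4, s4, h94, hF4⟩ := logLoop_spec (y := 9) (M := M2.write 0 8 (q ^ 64)) (x := q ^ 64) hX
    (by omega) (by omega) (by simp) haX
  have hA4 : Agree 5 [] M M4 := ⟨fun x hx => by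
      rw [hF4 0 x (by omega), Memory.write_apply, if_neg (by omega), hA2.1 x hx], fun b hb hbs i => by
      rw [hF4 b i (by omega), Memory.write_apply, if_neg (by omega), hA2.2 b hb hbs i]⟩
  have h54 : M4 0 5 = q ^ 64 := by rw [hF4 0 5 (by omega)]; simp [h52]
  have s5 := Program.Steps.assign (X := X) (b := 0) (M := M4) (i := .const 8) (e := .const 1)
    (by simp only [Expr.Fits]; omega) (by simp only [Expr.Fits]; omega) (by simp [Expr.nodes])
  simp only [Expr.eval] at s5
  set M5 := M4.write 0 8 1 with hM5
  have hA5 : Agree 5 [] M M5 := hA4.write_scalar (by omega)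
  have hN5 : (Expr.op .mul (.var 9) (.var 4)).eval M5 = a * d := by
    simp [Expr.eval, ArithOp.apply, hM5, h94, hA4.1 4 (by omega), h4, ha]
  obtain ⟨M6, s6, hA6, h56, h86⟩ := Program.Steps.countdown (X := X) (x := 10) (s := 1)
    (N := .op .mul (.var 9) (.var 4))
    (c := .assign 0 (.const 8) (.op .mul (.var 8) (.op .mul (.var 3) (.var 2))))
    (fun i M' => Agree 5 [] M M' ∧ M' 0 5 = q ^ 64 ∧ M' 0 8 = (n * q) ^ (a * d - i))
    (by omega) (by omega) (M := M5)
    (by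
      simp only [Expr.Fits]
      refine ⟨by omega, by omega, ?_⟩
      simpa only [Expr.eval, ArithOp.apply, hN5] using (show (Expr.op .mul (.var 9) (.var 4)).eval M5 ≤ X by
        rw [hN5]; exact hX2)) (by simp [Expr.nodes])
    (fun i M' v h => ⟨h.1.write_scalar (by omega), by simpa using h.2.1, by simpa using h.2.2⟩)
    (fun i hi M' hxi h => by
      obtain ⟨hA, h5, h8⟩ := h
      rw [hN5] at hi
      have hpow : (n * q) ^ (a * d - (i + 1)) * (n * q) = (n * q) ^ (a * d - i) := by
        rw [← pow_succ, show a * d - (i + 1) + 1 = a * d - i by omega]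
      have hle : (n * q) ^ (a * d - i) ≤ X :=
        le_trans (Nat.pow_le_pow_right (Nat.mul_pos (by omega) (by omega)) (Nat.sub_le _ _)) hX4
      have e2 := (hA.1 2 (by omega)).trans h2
      have e3 := (hA.1 3 (by omega)).trans h3
      have s := Program.Steps.assign (X := X) (b := 0) (M := M') (i := .const 8)
        (e := .op .mul (.var 8) (.op .mul (.var 3) (.var 2))) (by simp only [Expr.Fits]; omega)
        (by
          simp only [Expr.Fits, Expr.eval, ArithOp.apply, e2, e3, h8, hpow]
          exact ⟨by omega, ⟨by omega, by omega, hX3⟩, hle⟩) (by simp [Expr.nodes])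
      simp only [Expr.eval, ArithOp.apply, e2, e3, h8, hpow] at s
      exact ⟨_, s, by simpa using hxi, hA.write_scalar (by omega), by simpa using h5, by simp⟩)
    ⟨hA5, by simp [hM5, h54], by rw [hN5]; simp [hM5]⟩
  rw [hN5] at s6
  obtain ⟨M7, s7, h67, hF7⟩ := logLoop_spec (y := 6) (M := M6) (x := (n * q) ^ (a * d)) hX
    (by omega) (by omega) (by simpa using h86) ((Nat.log_le_self _ _).trans hX4)
  refine ⟨M7, s1.seq (s2.seq (s3.seq (s4.seq (s5.seq (s6.seq s7))))), ⟨fun x hx => ?_,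
    fun b hb hbs i => ?_⟩, ?_, h67⟩
  · rw [hF7 0 x (by omega), hA6.1 x hx]
  · rw [hF7 b i (by omega), hA6.2 b hb hbs i]
  · rw [hF7 0 5 (by omega), h56]

/-- The algorithm. -/
def coverProgram : Program :=
  .cond (.op .sub (.var 0) (.var 4))
    (.seq setupProgram
      (.seq (fillBank 8 5 (.var 0) (.const 1))
        (.seq (.countdown 7 (.var 6) peelRoundProgram)
          (fillBank 8 2 (.var 0) (.op .div (.read 5 (.var 8)) (.var 5))))))
    (fillBank 8 2 (.var 0) (.const 1))

def coverSteps (m k s a d R : ℕ) : ℕ :=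
  1 + (setupSteps a d R + (m * 3 + 2 + (R * (2 + roundSteps m k s) + 2 + (m * 3 + 2))))

/-- This branch keeps the running time polynomial: the main branch performs a number of steps that
grows linearly with d, so it is entered only for d < m. -/
theorem coverProgram_spec_of_le {X m k q d : ℕ} (hX : 100 ≤ X) {M : Memory} (hM : Dims m k q M)
    (h4 : M 0 4 = d) (hdm : m ≤ d) :
    ∃ M', coverProgram.Steps X M M' (1 + (m * 3 + 2)) ∧ outputSet m M' = Finset.univ := by
  have hN : (Expr.var 0).eval M = m := by simp [Expr.eval, hM.rows]
  obtain ⟨M', s, -, hv⟩ := fillBank_spec (X := X) (x := 8) (b := 2) (N := .var 0) (ex := .const 1)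
    (fun _ => 1) (by omega) (by omega) (by omega) (M := M) (by simp only [Expr.Fits]; omega)
    (by simp [Expr.nodes]) (by simp [Expr.nodes])
    (fun i hi M' hxi hA _ => ⟨by simp only [Expr.Fits]; omega, rfl⟩)
  rw [hN] at s hv
  refine ⟨M', Program.Steps.cond_false ?_ (by simp only [Expr.Fits]; omega) (by simp [Expr.nodes]) s,
    ?_⟩
  · simp [Expr.eval, ArithOp.apply, hM.rows, h4, hdm]
  · ext e
    simp [outputSet, hv e e.2]

theorem coverProgram_spec_of_lt {X m k q n d : ℕ} [NeZero q] (hX : LargeFor m k q X) (hq : 2 ≤ q)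
    (hn : 1 ≤ n) (hX1 : q ^ 64 * q ≤ X) (hX2 : Nat.log 2 (q ^ 64) * d ≤ X) (hX3 : n * q ≤ X)
    (hX4 : (n * q) ^ (Nat.log 2 (q ^ 64) * d) ≤ X)
    {C : Submodule (ZMod q) (Fin m → ZMod q)} {G : Matrix (Fin m) (Fin k) (ZMod q)}
    (hG : LinearMap.range G.mulVecLin = C) {M : Memory} (hM : Dims m k q M) (h3 : M 0 3 = n)
    (h4 : M 0 4 = d) (hMG : ∀ (r : Fin m) (c : Fin k), M 1 (r * k + c) = (G r c).val)
    (hdm : d < m) :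
    ∃ M', coverProgram.Steps X M M'
        (coverSteps m k (Nat.size q) (Nat.log 2 (q ^ 64)) d (roundCount q n d)) ∧
      outputSet m M' =
        (activeSet (q ^ 64) ((peelRound C (q ^ 64))^[roundCount q n d] fun _ => 1))ᶜ := by
  have hX100 := hX.hundred_le
  set R := roundCount q n d with hR
  have hX64 : q ^ 64 ≤ X := (Nat.le_mul_of_pos_right _ (by omega)).trans hX1
  obtain ⟨M1, s1, hA1, h51, h61⟩ := setupProgram_spec hX100 hq hn hX64 hX2 hX3 hX4 hM.modulus h3 h4
  have hd1 := hM.of_agree hA1 (by omega)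
  have hN1 : (Expr.var 0).eval M1 = m := by simp [Expr.eval, hd1.rows]
  obtain ⟨M2, s2, hA2, hv2⟩ := fillBank_spec (X := X) (x := 8) (b := 5) (N := .var 0)
    (ex := .const 1) (fun _ => 1) (by omega) (by omega) (by omega) (M := M1)
    (by simp only [Expr.Fits]; omega) (by simp [Expr.nodes]) (by simp [Expr.nodes])
    (fun i hi M' hxi hA _ => ⟨by simp only [Expr.Fits]; omega, rfl⟩)
  rw [hN1] at s2 hv2
  have hd2 := hd1.of_agree hA2 (by omega)
  have hN2 : (Expr.var 6).eval M2 = R := by simp [Expr.eval, hA2.1 6 (by omega), h61, hR]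
  obtain ⟨M3, s3, hA3, hacc3⟩ := Program.Steps.countdown (X := X) (x := 7)
    (s := roundSteps m k (Nat.size q)) (N := .var 6) (c := peelRoundProgram)
    (fun i M' => Agree 7 [3, 4, 5] M2 M' ∧
      ∀ e : Fin m, M' 5 e = (peelRound C (q ^ 64))^[R - i] (fun _ => 1) e)
    (by omega) (by omega) (M := M2) (by simp only [Expr.Fits]; omega) (by simp [Expr.nodes])
    (fun i M' v h => ⟨h.1.write_scalar le_rfl, fun e => by simpa using h.2 e⟩)
    (fun i hi M' hxi h => by
      obtain ⟨hA, hacc⟩ := h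
      rw [hN2] at hi
      have e5 : M' 0 5 = q ^ 64 := by rw [hA.1 5 (by omega), hA2.1 5 (by omega), h51]
      have e1 : ∀ i, M' 1 i = M 1 i := fun i => by
        rw [hA.2 1 (by omega) (by simp), hA2.2 1 (by omega) (by simp), hA1.2 1 (by omega) (by simp)]
      obtain ⟨M'', hs, hA', hacc'⟩ := peelRoundProgram_spec hX hX1 hG (hd2.of_agree hA (by omega))
        e5 (fun r c => by rw [e1, hMG]) hacc
      refine ⟨M'', hs, (hA'.1 7 (by omega)).trans hxi, hA.trans (hA'.mono (by omega) (by simp)),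
        fun e => ?_⟩
      rw [hacc' e, show R - i = R - (i + 1) + 1 by omega, Function.iterate_succ_apply'])
    ⟨Agree.refl _ _ _, fun e => by rw [hN2, Nat.sub_self, hv2 e e.2]; rfl⟩
  rw [hN2] at s3
  have hd3 := hd2.of_agree hA3 (by omega)
  have hN3 : (Expr.var 0).eval M3 = m := by simp [Expr.eval, hd3.rows]
  have h53 : M3 0 5 = q ^ 64 := by rw [hA3.1 5 (by omega), hA2.1 5 (by omega), h51]
  obtain ⟨M4, s4, -, hv4⟩ := fillBank_spec (X := X) (x := 8) (b := 2) (N := .var 0)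
    (ex := .op .div (.read 5 (.var 8)) (.var 5)) (fun i => M3 5 i / q ^ 64)
    (by omega) (by omega) (by omega) (M := M3)
    (by simp only [Expr.Fits]; omega) (by simp [Expr.nodes]) (by simp [Expr.nodes])
    (fun i hi M' hxi hA _ => ⟨by simp only [Expr.Fits]; omega, by
      simp only [Expr.eval, ArithOp.apply, hxi]
      rw [hA.1 5 (by omega), h53, hA.2 5 (by omega) (by simp)]⟩)
  rw [hN3] at s4 hv4
  refine ⟨M4, Program.Steps.cond_true ?_ (by simp only [Expr.Fits]; omega) (by simp [Expr.nodes])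
    (s1.seq (s2.seq (s3.seq s4))), ?_⟩
  · simp only [Expr.eval, ArithOp.apply, hM.rows, h4]; omega
  · ext e
    simp only [outputSet, Finset.mem_filter, Finset.mem_univ, true_and, Finset.mem_compl,
      mem_activeSet, hv4 e e.2, hacc3 e, Nat.sub_zero, not_lt]
    -- The indicator is the quotient of the accumulator by q^64, nonzero exactly when the threshold
    -- is reached.
    rw [Nat.div_ne_zero_iff]
    exact ⟨fun h => h.2, fun h => ⟨(Nat.pow_pos (by omega)).ne', h⟩⟩

/-! ### Running time and main theorem -/

/-- An upper bound, in terms of the input size, for the running time of `coverProgram`. -/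
def coverTime (N : ℕ) : ℕ :=
  coverSteps N N N (64 * N) N (128 * N ^ 3) * stepCost (2 ^ (200 * N ^ 3))

theorem exists_polynomial_coverTime : ∃ p : Polynomial ℕ, ∀ N, p.eval N = coverTime N := by
  let x : Polynomial ℕ := Polynomial.X
  let c := x * (2 + ((2 * x + 1) * (5 * x + 4) + 1)) + 2 +
    (1 + (1 + ((2 * x + 1) * 4 + 1 + (1 + (x * 3 + 2)))))
  let r := x * x * 3 + 2 + (x * 3 + 2 + (x * (2 + (1 + (c + 1))) + 2))
  let s := 1 + (6 * (2 + 1) + 2 + (1 + (64 * x * 3 + 2 + (1 + (64 * x * x * (2 + 1) + 2 +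
    (128 * x ^ 3 * 3 + 2))))))
  refine ⟨(1 + (s + (x * 3 + 2 + (128 * x ^ 3 * (2 + r) + 2 + (x * 3 + 2))))) *
    (40 * (1 + (200 * x ^ 3 + 1)) ^ 2), fun N => ?_⟩
  simp only [coverTime, coverSteps, setupSteps, roundSteps, contractSteps, stepCost, Nat.size_pow,
    x, c, r, s, Polynomial.eval_mul, Polynomial.eval_add, Polynomial.eval_pow, Polynomial.eval_X,
    Polynomial.eval_ofNat, Polynomial.eval_one]

theorem coverSteps_mono {m k s a d R m' k' s' a' d' R' : ℕ} (hm : m ≤ m') (hk : k ≤ k')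
    (hs : s ≤ s') (ha : a ≤ a') (hd : d ≤ d') (hR : R ≤ R') :
    coverSteps m k s a d R ≤ coverSteps m' k' s' a' d' R' := by
  unfold coverSteps setupSteps roundSteps contractSteps
  gcongr

theorem natLog_pow_le {x b B : ℕ} (hx : x < 2 ^ b) : Nat.log 2 (x ^ B) ≤ b * B := by
  calc Nat.log 2 (x ^ B) ≤ Nat.log 2 ((2 ^ b) ^ B) :=
        Nat.log_mono_right (Nat.pow_le_pow_left hx.le _)
    _ = b * B := by rw [← pow_mul, Nat.log_pow one_lt_two]

/-- The size of the input. -/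
def inputSize (q m k n d : ℕ) : ℕ := m + k + Nat.size q + Nat.size n + Nat.size d

/-! ### Bit lengths and iteration counts in terms of the input size -/

section Bounds

variable {q m k n d N : ℕ}

theorem natLog_pow_sixty_four_le (hN : Nat.size q ≤ N) : Nat.log 2 (q ^ 64) ≤ 64 * N := by
  have := natLog_pow_le (B := 64) (Nat.lt_size_self q)
  omega

theorem mul_lt_two_pow (hq : Nat.size q ≤ N) (hn : Nat.size n ≤ N) : n * q < 2 ^ (2 * N) := by
  rw [two_mul, pow_add]
  exact Nat.mul_lt_mul'' ((Nat.lt_size_self n).trans_le (Nat.pow_le_pow_right two_pos hn))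
    ((Nat.lt_size_self q).trans_le (Nat.pow_le_pow_right two_pos hq))

theorem exponent_le (hq : Nat.size q ≤ N) (hd : d ≤ N) :
    Nat.log 2 (q ^ 64) * d ≤ 64 * N ^ 2 := by
  calc Nat.log 2 (q ^ 64) * d ≤ (64 * N) * N := Nat.mul_le_mul (natLog_pow_sixty_four_le hq) hd
    _ = 64 * N ^ 2 := by ring

theorem roundCount_le_cube (hq : Nat.size q ≤ N) (hn : Nat.size n ≤ N) (hd : d ≤ N) :
    roundCount q n d ≤ 128 * N ^ 3 := by
  calc roundCount q n d ≤ 2 * N * (Nat.log 2 (q ^ 64) * d) := natLog_pow_le (mul_lt_two_pow hq hn)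
    _ ≤ 2 * N * (64 * N ^ 2) := Nat.mul_le_mul_left _ (exponent_le hq hd)
    _ = 128 * N ^ 3 := by ring

theorem exponent_le_two_pow (hq : Nat.size q ≤ N) (hd : d ≤ N) (hN : 1 ≤ N) :
    Nat.log 2 (q ^ 64) * d ≤ 2 ^ (8 * N) := by
  have h2 : 64 * N ^ 2 ≤ 2 ^ (6 * N) * (2 ^ N) ^ 2 := by
    refine Nat.mul_le_mul ?_ (Nat.pow_le_pow_left Nat.lt_two_pow_self.le 2)
    calc 64 = 2 ^ (6 * 1) := by norm_num
      _ ≤ 2 ^ (6 * N) := Nat.pow_le_pow_right two_pos (Nat.mul_le_mul_left _ hN)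
  calc _ ≤ 64 * N ^ 2 := exponent_le hq hd
    _ ≤ _ := h2
    _ = 2 ^ (8 * N) := by ring

/-- This power, whose logarithm is the number of rounds, motivates the cubic exponent in the common
bound for all cells. -/
theorem power_le (hq : Nat.size q ≤ N) (hn : Nat.size n ≤ N) (hd : d ≤ N) :
    (n * q) ^ (Nat.log 2 (q ^ 64) * d) ≤ 2 ^ (200 * N ^ 3) := by
  calc (n * q) ^ (Nat.log 2 (q ^ 64) * d) ≤ (2 ^ (2 * N)) ^ (Nat.log 2 (q ^ 64) * d) :=
        Nat.pow_le_pow_left (mul_lt_two_pow hq hn).le _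
    _ = 2 ^ (2 * N * (Nat.log 2 (q ^ 64) * d)) := (pow_mul _ _ _).symm
    _ ≤ 2 ^ (2 * N * (64 * N ^ 2)) :=
        Nat.pow_le_pow_right two_pos (Nat.mul_le_mul_left _ (exponent_le hq hd))
    _ ≤ 2 ^ (200 * N ^ 3) := Nat.pow_le_pow_right two_pos (by ring_nf; omega)

theorem le_two_pow_cube {x B : ℕ} (hx : x ≤ 2 ^ (B * N)) (hB : B ≤ 200) :
    x ≤ 2 ^ (200 * N ^ 3) := by
  refine hx.trans (Nat.pow_le_pow_right two_pos (Nat.mul_le_mul hB ?_))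
  exact Nat.le_self_pow (by norm_num) N

theorem largeFor_two_pow (hN : 1 ≤ N) (hq : Nat.size q ≤ N) (hm : m ≤ N) (hk : k ≤ N) :
    LargeFor m k q (2 ^ (200 * N ^ 3)) := by
  have hN2 : N < 2 ^ N := Nat.lt_two_pow_self
  have hq2 : q < 2 ^ N := (Nat.lt_size_self q).trans_le (Nat.pow_le_pow_right two_pos hq)
  refine ⟨?_, ?_, ?_⟩
  · refine le_two_pow_cube (B := 7) ?_ (by norm_num)
    calc 100 ≤ 2 ^ (7 * 1) := by norm_num
      _ ≤ 2 ^ (7 * N) := Nat.pow_le_pow_right two_pos (Nat.mul_le_mul_left _ hN)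
  · refine le_two_pow_cube (B := 2) ?_ (by norm_num)
    rw [two_mul, pow_add]
    exact Nat.mul_le_mul (by omega) (by omega)
  · refine le_two_pow_cube (B := 3) ?_ (by norm_num)
    have h1 : 2 ≤ 2 ^ N := by
      calc 2 = 2 ^ 1 := by norm_num
        _ ≤ 2 ^ N := Nat.pow_le_pow_right two_pos hN
    have h2 : (2 : ℕ) ^ (3 * N) = 2 ^ N * (2 ^ N * 2 ^ N) := by ring
    rw [h2]
    nlinarith

theorem threshold_mul_le (hq : Nat.size q ≤ N) :
    q ^ 64 * q ≤ 2 ^ (200 * N ^ 3) := by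
  refine le_two_pow_cube (B := 65) ?_ (by norm_num)
  rw [← pow_succ, mul_comm, pow_mul]
  exact Nat.pow_le_pow_left
    ((Nat.lt_size_self q).le.trans (Nat.pow_le_pow_right two_pos hq)) _

theorem inputMemory_le [NeZero q] (G : Matrix (Fin m) (Fin k) (ZMod q)) (b i : ℕ) :
    inputMemory G n d b i ≤ 2 ^ inputSize q m k n d := by
  have hpow : ∀ {x y : ℕ}, x < 2 ^ y → y ≤ inputSize q m k n d → x ≤ 2 ^ inputSize q m k n d :=
    fun hx hy => hx.le.trans (Nat.pow_le_pow_right two_pos hy)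
  unfold inputMemory
  split
  · exact hpow Nat.lt_two_pow_self (by unfold inputSize; omega)
  · exact hpow Nat.lt_two_pow_self (by unfold inputSize; omega)
  · exact hpow (Nat.lt_size_self q) (by unfold inputSize; omega)
  · exact hpow (Nat.lt_size_self n) (by unfold inputSize; omega)
  · exact hpow (Nat.lt_size_self d) (by unfold inputSize; omega)
  · split_ifs
    · exact hpow ((ZMod.val_lt _).trans (Nat.lt_size_self q)) (by unfold inputSize; omega)
    · exact Nat.zero_le _
  · exact Nat.zero_le _

end Bounds

theorem inputMemory_entry {q m k n d : ℕ} (G : Matrix (Fin m) (Fin k) (ZMod q)) (r : Fin m)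
    (c : Fin k) : inputMemory G n d 1 (r * k + c) = (G r c).val := by
  have hlt := index_lt r.2 c.2
  simp only [inputMemory]
  rw [dif_pos hlt]
  congr 2
  · ext
    simp only [Fin.coe_divNat]
    rw [mul_comm, Nat.mul_add_div (by omega), Nat.div_eq_of_lt c.2, add_zero]
  · ext
    simp only [Fin.coe_modNat]
    rw [Nat.mul_add_mod', Nat.mod_eq_of_lt c.2]

theorem one_le_logb_two {q : ℕ} (hq : 2 ≤ q) : 1 ≤ Real.logb 2 q := by
  have hq' : (2 : ℝ) ≤ q := by exact_mod_cast hq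
  rwa [Real.le_logb_iff_rpow_le one_lt_two (by linarith), Real.rpow_one]

theorem le_cover_bound {q n d : ℕ} (hq : 2 ≤ q) (hn : 1 ≤ n) :
    (d : ℝ) ≤ n * d * Real.logb 2 q * (Real.logb 2 n + Real.logb 2 q) := by
  have hn' : (1 : ℝ) ≤ n := by exact_mod_cast hn
  have hl := one_le_logb_two hq
  have hln : 0 ≤ Real.logb 2 n := Real.logb_nonneg one_lt_two hn'
  have hd : (0 : ℝ) ≤ d := Nat.cast_nonneg d
  have h2 : (d : ℝ) ≤ n * d := le_mul_of_one_le_left hd hn'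
  have h3 : (n : ℝ) * d ≤ n * d * Real.logb 2 q := le_mul_of_one_le_right (by positivity) hl
  exact (h2.trans h3).trans (le_mul_of_one_le_right (by positivity) (by linarith))

theorem card_removed_le {q m n d : ℕ} [NeZero q] (hq : 2 ≤ q) (hn : 1 ≤ n)
    {C : Submodule (ZMod q) (Fin m → ZMod q)} (hC : Nat.card C ≤ q ^ n) :
    (((activeSet (q ^ 64) ((peelRound C (q ^ 64))^[roundCount q n d] fun _ => 1))ᶜ).card : ℝ) ≤
      n * d * Real.logb 2 q * (Real.logb 2 n + Real.logb 2 q) := by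
  have h1 := card_removed_mul_le (a := 64) (R := roundCount q n d) hq hC
  generalize ((activeSet (q ^ 64) ((peelRound C (q ^ 64))^[roundCount q n d] fun _ => 1))ᶜ).card = T
    at h1 ⊢
  have h2 : (64 : ℝ) * T ≤ n * roundCount q n d := by exact_mod_cast h1
  have h3 := mul_le_mul_of_nonneg_left (roundCount_le (d := d) hq hn) (Nat.cast_nonneg (α := ℝ) n)
  linarith

theorem coverProgram_run {q m n d k : ℕ} (hq : 2 ≤ q) (hn : 1 ≤ n) (hd : 1 ≤ d)
    {C : Submodule (ZMod q) (Fin m → ZMod q)} (hC : Nat.card C ≤ q ^ n) {S : Finset (Fin m)}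
    (hS : IsExtremal C d S) (G : Matrix (Fin m) (Fin k) (ZMod q))
    (hG : LinearMap.range G.mulVecLin = C) :
    ∃ (M : Memory) (t : ℕ), coverProgram.Run (inputMemory G n d) M t ∧
      t ≤ coverTime (inputSize q m k n d) ∧ S ⊆ outputSet m M ∧
      ((outputSet m M).card : ℝ) ≤ n * d * Real.logb 2 q * (Real.logb 2 n + Real.logb 2 q) := by
  have : NeZero q := ⟨by omega⟩
  have hN : inputSize q m k n d = m + k + Nat.size q + Nat.size n + Nat.size d := rfl
  have hmem := inputMemory_le (n := n) (d := d) G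
  generalize inputSize q m k n d = N at hN hmem ⊢
  have hsq : 0 < Nat.size q := Nat.size_pos.2 (by omega)
  have hN1 : 1 ≤ N := by omega
  have hqN : Nat.size q ≤ N := by omega
  have hnN : Nat.size n ≤ N := by omega
  have hmN : m ≤ N := by omega
  have hkN : k ≤ N := by omega
  clear hN
  have hlarge := largeFor_two_pow hN1 hqN hmN hkN
  have hdims : Dims m k q (inputMemory G n d) := ⟨rfl, rfl, rfl⟩
  have hmem : ∀ b i, inputMemory G n d b i ≤ 2 ^ (200 * N ^ 3) := fun b i =>
    le_two_pow_cube (B := 1) (by rw [one_mul]; exact hmem b i) (by norm_num)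
  -- For m ≤ d the whole of [m] satisfies the size bound, which is at least d. For d < m the value
  -- of d, not only its length, is at most the input size.
  rcases le_or_gt m d with hmd | hmd
  · obtain ⟨M, hs, hout⟩ := coverProgram_spec_of_le hlarge.hundred_le hdims rfl hmd
    obtain ⟨⟨t, hrun, ht⟩, -⟩ := hs hmem
    refine ⟨M, t, hrun, ht.trans (Nat.mul_le_mul_right _ ?_), ?_, ?_⟩
    · unfold coverSteps; omega
    · rw [hout]; exact Finset.subset_univ _
    · rw [hout, Finset.card_univ, Fintype.card_fin]
      exact (Nat.cast_le.2 hmd).trans (le_cover_bound hq hn)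
  · have hdN : d ≤ N := by omega
    obtain ⟨M, hs, hout⟩ := coverProgram_spec_of_lt hlarge hq hn (threshold_mul_le hqN)
      (le_two_pow_cube (exponent_le_two_pow hqN hdN hN1) (by norm_num))
      (le_two_pow_cube (mul_lt_two_pow hqN hnN).le (by norm_num))
      (power_le hqN hnN hdN) hG hdims rfl rfl (inputMemory_entry G) hmd
    obtain ⟨⟨t, hrun, ht⟩, -⟩ := hs hmem
    refine ⟨M, t, hrun, ht.trans (Nat.mul_le_mul_right _ ?_), ?_, ?_⟩
    · exact coverSteps_mono hmN hkN hqN (natLog_pow_sixty_four_le hqN) hdN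
        (roundCount_le_cube hqN hnN hdN)
    · rw [hout]
      exact hS.subset_removed hq hn hd hC (le_roundCount hq hn hd)
    · rw [hout]
      exact card_removed_le hq hn hC

theorem mainTheorem12 :
    ∃ (A : Program) (p : Polynomial ℕ),
      ∀ (q m n d : ℕ), 2 ≤ q → 1 ≤ n → 1 ≤ d →
      ∀ C : Submodule (ZMod q) (Fin m → ZMod q), Nat.card C ≤ q ^ n →
      ∃ S : Finset (Fin m),
        (S.card : ℝ) ≤ n * Real.logb 2 q * d ∧
        (∀ α : ℕ, 1 ≤ α →
          (numLightCodewords (puncture C S) (α * d) : ℝ) ≤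
            max 1 (Ring.choose ((n : ℝ) * Real.logb 2 q) α) * (q : ℝ) ^ (α + 1)) ∧
        ∀ (k : ℕ) (G : Matrix (Fin m) (Fin k) (ZMod q)), LinearMap.range G.mulVecLin = C →
          ∃ (M : Memory) (t : ℕ),
            A.Run (inputMemory G n d) M t ∧
            t ≤ p.eval (m + k + Nat.size q + Nat.size n + Nat.size d) ∧
            S ⊆ outputSet m M ∧
            ((outputSet m M).card : ℝ) ≤
              n * d * Real.logb 2 q * (Real.logb 2 n + Real.logb 2 q) := by
  obtain ⟨p, hp⟩ := exists_polynomial_coverTime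
  refine ⟨coverProgram, p, fun q m n d hq hn hd C hC => ?_⟩
  have : NeZero q := ⟨by omega⟩
  obtain ⟨S, hS⟩ := exists_isExtremal C d
  refine ⟨S, ?_, fun α hα => hS.numLightCodewords_le hq hd hα hC, fun k G hG => ?_⟩
  · have := mul_le_mul_of_nonneg_left (logb_card_vanishingOn_le hC Sᶜ) (Nat.cast_nonneg (α := ℝ) d)
    linarith [hS.card_le]
  · rw [hp]
    exact coverProgram_run hq hn hd hC hS G hG
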